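/- Let $n>1$ and $m\ge 1$ be integers, let $q=2^n$, and let $F=\mathbb{F}_{q^m}$ be the finite field with $q^m$ elements. Let $T(x)=\sum_{i=0}^{n-1}x^{2^i-1}$ and $C(x)=x\,T(x)^{q+1}\in F[x]$. For every $a\in F$ with $a\neq 0$, the polynomial $C(x)+a$ has exactly $0$, $1$, $q/2$, or $(q/2)(q-1)$ distinct roots in $F$. Let $c_i$ denote the number of $a\in F^\times$ for which $C(x)+a$ has exactly $i$ distinct roots in $F$. If $m$ is even, then $$c_0=\frac{(q-2)(q^m-1)}{2(q-1)},\qquad c_1=\frac{q^{m+1}-q}{2(q+1)},\qquad c_{q/2}=q^{m-1},\qquad c_{(q/2)(q-1)}=\frac{q^{m-1}-q}{q^2-1}.$$ If $m$ is odd, then $$c_0=\frac{(q-2)(q^m-1)}{2(q-1)},\qquad c_1=\frac{q^{m+1}+q}{2(q+1)},\qquad c_{q/2}=q^{m-1}-1,\qquad c_{(q/2)(q-1)}=\frac{q^{m-1}-1}{q^2-1}.$$ -/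

import Mathlib

open Polynomial

/-- The polynomial `T(x) = ∑_{i=0}^{n-1} x^(2^i - 1)`. -/
noncomputable def mcmT (F : Type*) [Field F] (n : ℕ) : F[X] :=
  ∑ i ∈ Finset.range n, X ^ (2 ^ i - 1)

/-- The Müller–Cohen–Matthews polynomial `C(x) = x * T(x)^(q+1)`, where `q = 2^n`. -/
noncomputable def mcmC (F : Type*) [Field F] (n : ℕ) : F[X] :=
  X * mcmT F n ^ (2 ^ n + 1)

/-- The number of (distinct) roots of `C(x) + a` lying in `F`. -/
noncomputable def numRoots {F : Type*} [Field F] (n : ℕ) (a : F) : ℕ :=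
  Set.ncard {x : F | (mcmC F n + Polynomial.C a).IsRoot x}

/-- `rootCount F n i` is the number `c_i` of nonzero `a ∈ F` for which `C(x) + a` has
exactly `i` roots in `F`. -/
noncomputable def rootCount (F : Type*) [Field F] (n i : ℕ) : ℕ :=
  Set.ncard {a : F | a ≠ 0 ∧ numRoots n a = i}

/-! Let `K` be an algebraic closure of `F`, `φ` its `q`-power map and `N z = z * φ z`. For `y = p ^
2 + p` the sum `y * T(y)` telescopes to `φ p + p`, so `C(y) * y ^ q = N (φ p + p)`. Writing `p = N
v`, `1 + p = N w` and `a = N l` turns `C(y) = a ≠ 0` into the frame equations for `(v, w)`, with `y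
= N v * N w` (`IsFrame.eval_mcmC`, `exists_frame`).

For fixed `l ≠ 0` the frames are a torsor under the special unitary group of pairs `(A, B)` over
`𝔽_{q²}` with `N A + N B = 1`, and `y` determines a frame up to norm-one scaling and swapping. Hence
the roots of `C(y) = a` in `K` are the slopes `k = B / A` in `𝔽_{q²}` with `N k ≠ 1`, where `k` is
identified with `1 / φ k` and `0` with the infinite slope.

If `y` is rational, the `q ^ m`-power map sends `p` to `p` or `p + 1`, so up to norm-one factors it
preserves or swaps `v` and `w`. On slopes it becomes `k ↦ k * r` or `k ↦ φ k * r` with `N r = 1`;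
which of the two depends on the parity of `m` and on whether there is a swap. The first fixes every
slope (`r = 1`) or only `0`, giving `(q/2)(q-1)` roots or one; the second fixes `q - 1` slopes,
giving `q/2` roots.

Counting the points `p` of each kind gives linear equations for the `c_i` (`valueCount_of_split`).
The condition `r = 1` is read off from `t = v / w`, which solves `N t = p / (p + 1)`. -/

/-- A pair `(v, w)` of norm one for the form `N v + N w`, where `N z = z * φ z`, satisfying the
semilinear system with parameter `l`. -/
structure IsFrame {K : Type*} [Field K] (φ : K →+* K) (l v w : K) : Prop where
  norm : v * φ v + w * φ w = 1
  left : φ (φ v) = v + l * φ w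
  right : φ (φ w) = w + l * φ v

/-- The invariant of the frame obtained from `(v, w)` by the transformation with slope `k`. -/
noncomputable def slopeInvariant {K : Type*} [Field K] (φ : K →+* K) (v w k : K) : K :=
  (v + k * w) * φ (v + k * w) * ((φ k * v + w) * φ (φ k * v + w)) / (1 + k * φ k) ^ 2

/-! ### Frames and the unitary group acting on them -/

section Frame

variable {K : Type*} [Field K] {φ : K →+* K} {l v w v' w' : K}

theorem IsFrame.swap (h : IsFrame φ l v w) : IsFrame φ l w v :=
  ⟨by rw [add_comm, h.norm], h.right, h.left⟩

theorem IsFrame.left_ne_zero (h : IsFrame φ l v w) (hl : l ≠ 0) : v ≠ 0 := by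
  rintro rfl
  have h1 := h.left
  have h2 := h.norm
  simp [hl] at h1
  simp [h1] at h2

theorem IsFrame.right_ne_zero (h : IsFrame φ l v w) (hl : l ≠ 0) : w ≠ 0 :=
  h.swap.left_ne_zero hl

theorem slopeInvariant_zero :
    slopeInvariant φ v w 0 = v * φ v * (w * φ w) := by
  simp [slopeInvariant]

/-- With `B = k * A`, the normalisation reads `N A * (1 + N k) = 1`, so the invariant of the
transformed frame depends on `k` alone. -/
theorem slopeInvariant_eq {A B k : K} (hA : φ (φ A) = A) (hAB : A * φ A + B * φ B = 1)
    (hk : φ (φ k) = k) (hB : B = k * A) : slopeInvariant φ v w k =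
      (A * v + B * w) * φ (A * v + B * w) *
        ((φ B * v + φ A * w) * φ (φ B * v + φ A * w)) := by
  subst hB
  have h0 : (A * φ A) * (1 + k * φ k) = 1 := by
    rw [map_mul] at hAB
    linear_combination hAB
  have h1 : 1 + k * φ k ≠ 0 := right_ne_zero_of_mul_eq_one h0
  rw [slopeInvariant, div_eq_iff (pow_ne_zero _ h1)]
  simp only [map_add, map_mul, hA, hk]
  linear_combination (-(v + k * w) * (φ v + φ k * φ w) * ((φ k * v + w) * (k * φ v + φ w)))
    * (A * φ A * (1 + k * φ k) + 1) * h0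

/-- The ratio `z = v' / v` has norm one, hence is fixed by `φ ∘ φ`; the equation for `φ (φ v)` then
determines `w'`. -/
theorem IsFrame.of_norm_eq (h : IsFrame φ l v w) (h' : IsFrame φ l v' w') (hl : l ≠ 0)
    (hv : v' * φ v' = v * φ v) : ∃ z, z * φ z = 1 ∧ v' = z * v ∧ w' = φ z * w := by
  have hv0 := h.left_ne_zero hl
  have hw0 := h.right_ne_zero hl
  have hv0' := h'.left_ne_zero hl
  have hφv0 : φ v ≠ 0 := by simpa using hv0
  have hφw0 : φ w ≠ 0 := by simpa using hw0
  have e1 := h.norm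
  have e2 := h.left
  have f1 := h'.norm
  have f2 := h'.left
  have hz : v' / v * φ (v' / v) = 1 := by
    rw [map_div₀]; field_simp; exact hv
  have k1 : v' = v' / v * v := by field_simp
  generalize v' / v = z at *
  have hz0 : φ z ≠ 0 := fun h0 => by simp [h0] at hz
  have hz' : φ z * φ (φ z) = 1 := by simpa using congrArg φ hz
  have k2 : φ (φ z) = z := by
    apply (mul_right_inj' hz0).1
    rw [hz', mul_comm, hz]
  refine ⟨z, hz, k1, ?_⟩
  apply φ.injective
  rw [map_mul, k2]
  apply (mul_right_inj' hl).1
  rw [k1] at f2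
  simp only [map_mul, k2, e2] at f2
  linear_combination -f2

variable [CharP K 2]

/-- Linear independence of `v` and `w` over the quadratic field: applying `φ ∘ φ` to a relation
gives a second one, and the determinant of the two is `N v + N w = 1` in characteristic 2. -/
theorem IsFrame.left_coeff_eq_zero (h : IsFrame φ l v w) (hl : l ≠ 0) {c d : K}
    (hc : φ (φ c) = c) (hd : φ (φ d) = d) (h0 : c * v + d * w = 0) : c = 0 := by
  have h1 : φ (φ (c * v + d * w)) = 0 := by simp [h0]
  simp only [map_add, map_mul, hc, hd, h.left, h.right] at h1
  have h2 : c * φ w + d * φ v = 0 := by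
    apply (mul_right_inj' hl).1
    linear_combination h1 - h0
  have h3 := h.norm
  have h4 : (2 : K) = 0 := CharTwo.two_eq_zero
  linear_combination (-c) * h3 + φ v * h0 + w * h2 - d * w * φ v * h4

theorem IsFrame.coeff_eq (h : IsFrame φ l v w) (hl : l ≠ 0) {a b c d : K}
    (ha : φ (φ a) = a) (hb : φ (φ b) = b) (hc : φ (φ c) = c) (hd : φ (φ d) = d)
    (h0 : a * v + b * w = c * v + d * w) : a = c ∧ b = d := by
  constructor
  · have := h.left_coeff_eq_zero hl (c := a - c) (d := b - d) (by simp [ha, hc])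
      (by simp [hb, hd]) (by linear_combination h0)
    linear_combination this
  · have := h.swap.left_coeff_eq_zero hl (c := b - d) (d := a - c) (by simp [hb, hd])
      (by simp [ha, hc]) (by linear_combination h0)
    linear_combination this

theorem IsFrame.transform (h : IsFrame φ l v w) {A B : K} (hA : φ (φ A) = A) (hB : φ (φ B) = B)
    (hAB : A * φ A + B * φ B = 1) : IsFrame φ l (A * v + B * w) (φ B * v + φ A * w) := by
  have h4 : (2 : K) = 0 := CharTwo.two_eq_zero
  have h1 := h.norm
  have h2 := h.left
  have h3 := h.right
  constructor <;> simp only [map_add, map_mul, hA, hB, h2, h3]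
  · grind
  · grind
  · grind

theorem IsFrame.exists_transform (h : IsFrame φ l v w) (h' : IsFrame φ l v' w') :
    ∃ A B : K, φ (φ A) = A ∧ φ (φ B) = B ∧ A * φ A + B * φ B = 1 ∧
      v' = A * v + B * w ∧ w' = φ B * v + φ A * w := by
  have h4 : (2 : K) = 0 := CharTwo.two_eq_zero
  have e1 := h.norm
  have e2 := h.left
  have e3 := h.right
  have f1 := h'.norm
  have f2 := h'.left
  have f3 := h'.right
  -- `A` and `B` come from Cramer's rule for `A * v + B * w = v'`, `A * φ w + B * φ v = φ w'`, whose
  -- determinant is `1`.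
  have hA : φ (φ (v' * φ v + φ w' * w)) = v' * φ v + φ w' * w := by
    simp only [map_add, map_mul, e2, e3, f2, f3]
    linear_combination (l * φ w' * φ v + φ l * v' * w + l * φ l * v' * φ v
      + l * φ l * φ w' * w + l ^ 2 * φ l * φ w' * φ v) * h4
  have hB : φ (φ (v * φ w' + φ w * v')) = v * φ w' + φ w * v' := by
    simp only [map_add, map_mul, e2, e3, f2, f3]
    linear_combination (l * φ w' * φ w + φ l * v' * v + l * φ l * v' * φ w
      + l * φ l * φ w' * v + l ^ 2 * φ l * φ w' * φ w) * h4
  have k1 : v' = (v' * φ v + φ w' * w) * v + (v * φ w' + φ w * v') * w := by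
    linear_combination (-v') * e1 - (φ w' * v * w) * h4
  have k2 : w' = φ (v * φ w' + φ w * v') * v + φ (v' * φ v + φ w' * w) * w := by
    apply φ.injective
    rw [map_add φ (φ (v * φ w' + φ w * v') * v), map_mul φ (φ (v * φ w' + φ w * v')) v,
      map_mul φ (φ (v' * φ v + φ w' * w)) w, hA, hB]
    linear_combination (-φ w') * e1 - (v' * φ v * φ w) * h4
  generalize v' * φ v + φ w' * w = A at *
  generalize v * φ w' + φ w * v' = B at *
  refine ⟨A, B, hA, hB, ?_, k1, k2⟩
  have k3 : φ v' = φ A * φ v + φ B * φ w := by rw [k1]; simp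
  have k4 : φ w' = B * φ v + A * φ w := by rw [k2]; simp [hA, hB]
  rw [k3, k4] at f1
  have f1' : (A * v + B * w) * (φ A * φ v + φ B * φ w)
    + (φ B * v + φ A * w) * (B * φ v + A * φ w) = 1 := by rw [← k1, ← k2]; exact f1
  linear_combination f1' - (A * φ A + B * φ B) * e1
    - (A * φ B * v * φ w + B * φ A * w * φ v) * h4

theorem IsFrame.of_invariant_eq (h : IsFrame φ l v w) (h' : IsFrame φ l v' w') (hl : l ≠ 0)
    (hx : v' * φ v' * (w' * φ w') = v * φ v * (w * φ w)) : ∃ z, z * φ z = 1 ∧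
      ((v' = z * v ∧ w' = φ z * w) ∨ (v' = z * w ∧ w' = φ z * v)) := by
  have h4 : (2 : K) = 0 := CharTwo.two_eq_zero
  have e1 := h.norm
  have f1 := h'.norm
  -- Both norms are roots of the same quadratic, since the two norms of a frame have sum `1` and
  -- product the invariant.
  have : (v' * φ v' - v * φ v) * (v' * φ v' - w * φ w) = 0 := by
    linear_combination (-1) * hx + v' * φ v' * f1 - v' * φ v' * e1
  rcases mul_eq_zero.1 this with h0 | h0
  · obtain ⟨z, hz, h1, h2⟩ := h.of_norm_eq h' hl (sub_eq_zero.1 h0)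
    exact ⟨z, hz, Or.inl ⟨h1, h2⟩⟩
  · obtain ⟨z, hz, h1, h2⟩ := h.swap.of_norm_eq h' hl (sub_eq_zero.1 h0)
    exact ⟨z, hz, Or.inr ⟨h1, h2⟩⟩

/-- Passing from `k` to `1 / φ k` exchanges the two vectors of the transformed frame up to scalars.
-/
theorem slopeInvariant_inv {k k' : K} (hk : φ (φ k) = k) (hkk : k' * φ k = 1)
    (hN : k * φ k ≠ 1) :
    slopeInvariant φ v w k' = slopeInvariant φ v w k := by
  have hk0 : φ k ≠ 0 := right_ne_zero_of_mul_eq_one hkk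
  have hk1 : k ≠ 0 := by simpa using hk0
  have hk' : k' = (φ k)⁻¹ := eq_inv_of_mul_eq_one_left hkk
  have h1 : 1 + k * φ k ≠ 0 := fun h => hN (by
    have := CharTwo.add_eq_zero.1 h
    exact this.symm)
  subst hk'
  simp only [slopeInvariant, map_add, map_mul, map_inv₀, hk]
  field_simp
  ring

end Frame

/-! ### Roots of `C(x) = a` over the algebraic closure -/

section Fibre

variable {K : Type*} [Field K]

theorem mul_eval_mcmT (n : ℕ) (y : K) :
    y * (mcmT K n).eval y = ∑ i ∈ Finset.range n, y ^ 2 ^ i := by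
  rw [mcmT, eval_finsetSum, Finset.mul_sum]
  refine Finset.sum_congr rfl fun i _ => ?_
  rw [eval_pow, eval_X, mul_pow_sub_one (by positivity)]

variable [CharP K 2]

/-- The Frobenius endomorphism `x ↦ x ^ (2 ^ n)`. -/
noncomputable def frob (K : Type*) [Field K] [CharP K 2] (n : ℕ) : K →+* K :=
  iterateFrobenius K 2 n

theorem frob_apply (n : ℕ) (x : K) : frob K n x = x ^ 2 ^ n := by
  simp [frob, iterateFrobenius_def]

theorem frob_comm (n m : ℕ) (x : K) : frob K n (frob K m x) = frob K m (frob K n x) := by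
  simp only [frob_apply, ← pow_mul, mul_comm]

theorem mul_frob (n : ℕ) (x : K) : x * frob K n x = x ^ (2 ^ n + 1) := by
  rw [frob_apply, pow_succ, mul_comm]

/-- The sum telescopes because squaring is additive and signs vanish. -/
theorem sum_pow_two_pow (n : ℕ) (p : K) :
    ∑ i ∈ Finset.range n, (p ^ 2 + p) ^ 2 ^ i = frob K n p + p := by
  have h : ∀ i, (p ^ 2 + p) ^ 2 ^ i = p ^ 2 ^ (i + 1) - p ^ 2 ^ i := by
    intro i
    rw [add_pow_char_pow, ← pow_mul, pow_succ' 2 i, CharTwo.sub_eq_add]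
  simp_rw [h]
  rw [Finset.sum_range_sub (fun i => p ^ 2 ^ i), frob_apply, CharTwo.sub_eq_add]
  simp

theorem eval_mcmC_mul (n : ℕ) (p : K) :
    (mcmC K n).eval (p ^ 2 + p) * frob K n (p ^ 2 + p) =
      (frob K n p + p) * frob K n (frob K n p + p) := by
  rw [← sum_pow_two_pow, ← mul_eval_mcmT, mcmC, mul_frob, frob_apply]
  simp only [eval_mul, eval_pow, eval_X, mul_pow]
  ring

theorem eval_mcmC_ne_zero_iff {n : ℕ} (p : K) :
    (mcmC K n).eval (p ^ 2 + p) ≠ 0 ↔ frob K n p ≠ p := by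
  have h := eval_mcmC_mul n p
  rw [mcmC, eval_mul, eval_pow, eval_X, ne_eq, mul_eq_zero, pow_eq_zero_iff (by positivity),
    ← mul_eq_zero, mul_eval_mcmT, sum_pow_two_pow, CharTwo.add_eq_zero]

theorem IsFrame.eval_mcmC {n : ℕ} {l v w : K} (h : IsFrame (frob K n) l v w) (hl : l ≠ 0) :
    (mcmC K n).eval (v * frob K n v * (w * frob K n w)) = l * frob K n l := by
  have h4 : (2 : K) = 0 := CharTwo.two_eq_zero
  have hv := h.left_ne_zero hl
  have hw := h.right_ne_zero hl
  have h1 := h.norm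
  have h2 := h.left
  have h3 := h.right
  have hx : v * frob K n v * (w * frob K n w) = (v * frob K n v) ^ 2 + v * frob K n v := by
    linear_combination (v * frob K n v) * h1 - (v * frob K n v) ^ 2 * h4
  have hp : frob K n (v * frob K n v) + v * frob K n v = l * frob K n v * frob K n w := by
    rw [map_mul, h2]
    linear_combination (v * frob K n v) * h4
  have h5 := eval_mcmC_mul n (v * frob K n v)
  rw [hp, ← hx] at h5
  have h0 : frob K n (v * frob K n v * (w * frob K n w)) ≠ 0 := by simp [hv, hw]
  apply mul_right_cancel₀ h0
  rw [h5]
  simp only [map_mul]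
  ring

variable [IsAlgClosed K]

theorem exists_mul_frob_eq (n : ℕ) (c : K) : ∃ z, z * frob K n z = c := by
  simp_rw [mul_frob]
  exact IsAlgClosed.exists_pow_nat_eq c (by positivity)

theorem exists_frame {n : ℕ} {l p : K} (hl : l ≠ 0)
    (h : (mcmC K n).eval (p ^ 2 + p) = l * frob K n l) :
    ∃ v w, IsFrame (frob K n) l v w ∧ v * frob K n v = p := by
  have h4 : (2 : K) = 0 := CharTwo.two_eq_zero
  have hne : frob K n p ≠ p := by
    rw [← eval_mcmC_ne_zero_iff, h]
    simp [hl]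
  obtain ⟨v, hv⟩ := exists_mul_frob_eq n p
  obtain ⟨w, hw⟩ := exists_mul_frob_eq n (1 + p)
  have hv0 : v ≠ 0 := by
    rintro rfl
    simp at hv
    simp [← hv] at hne
  have hw0 : w ≠ 0 := by
    rintro rfl
    simp at hw
    have : p = 1 := by linear_combination -hw - h4
    simp [this] at hne
  have hφv0 : frob K n v ≠ 0 := by simpa using hv0
  have hφw0 : frob K n w ≠ 0 := by simpa using hw0
  have hvw : frob K n (v * w) ≠ 0 := by simp [hv0, hw0]
  -- Any frame over the chosen `v`, `w` forces this parameter. It has the same norm as `l`, so only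
  -- a norm-one discrepancy remains.
  obtain ⟨l', hl'⟩ : ∃ l', l' * frob K n (v * w) = frob K n p + p :=
    ⟨(frob K n p + p) / frob K n (v * w), by field_simp⟩
  have hll : l' * frob K n l' = l * frob K n l := by
    rw [← h]
    have h5 := eval_mcmC_mul n p
    rw [← hl'] at h5
    have h6 : p ^ 2 + p = v * w * frob K n (v * w) := by
      rw [map_mul]
      linear_combination (-w * frob K n w) * hv - p * hw
    have h7 : frob K n (p ^ 2 + p) ≠ 0 := by
      rw [h6]; simp [hv0, hw0]
    apply mul_right_cancel₀ h7
    rw [h5]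
    rw [h6]
    simp only [map_mul]
    ring
  -- Scaling `v` and `w` by a norm-one `e` multiplies the parameter by `e ^ 2`, so a square root of
  -- `l / l'` is needed; in characteristic 2 it again has norm one.
  obtain ⟨e, he⟩ := IsAlgClosed.exists_pow_nat_eq (l / l') (n := 2) (by norm_num)
  have hl'0 : l' ≠ 0 := by
    rintro rfl
    simp [hl] at hll
  have hφl'0 : frob K n l' ≠ 0 := by simpa using hl'0
  have heN : e * frob K n e = 1 := by
    have : (e * frob K n e) ^ 2 = 1 := by
      rw [mul_pow, ← map_pow, he, map_div₀]
      field_simp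
      exact hll.symm
    exact CharTwo.sq_injective (by simpa using this)
  have he0 : frob K n e ≠ 0 := right_ne_zero_of_mul_eq_one heN
  have heN' : frob K n (frob K n e) = e := by
    have : frob K n e * frob K n (frob K n e) = 1 := by simpa using congrArg (frob K n) heN
    apply mul_left_cancel₀ he0
    rw [this, mul_comm, heN]
  have hle : l = e ^ 2 * l' := by rw [he]; field_simp
  have hφp : frob K n p = frob K n v * frob K n (frob K n v) := by rw [← hv]; simp
  have hφp' : 1 + frob K n p = frob K n w * frob K n (frob K n w) := by
    have := congrArg (frob K n) hw
    simp only [map_mul, map_add, map_one] at this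
    exact this.symm
  rw [map_mul] at hl'
  refine ⟨e * v, e * w, ⟨?_, ?_, ?_⟩, ?_⟩
  · rw [map_mul, map_mul]
    linear_combination (v * frob K n v + w * frob K n w) * heN + hv + hw + p * h4
  · simp only [map_mul, heN', hle]
    apply mul_left_cancel₀ hφv0
    linear_combination (-e) * hφp - (e * frob K n v * frob K n w * l') * heN
      - e * hl' - e * hv - (e * p) * h4
  · simp only [map_mul, heN', hle]
    apply mul_left_cancel₀ hφw0
    linear_combination (-e) * hφp' - (e * frob K n v * frob K n w * l') * heN
      - e * hl' - e * hw - (e * p) * h4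
  · rw [map_mul]
    linear_combination (v * frob K n v) * heN + hv

/-- The admissible slopes: elements of the quadratic subfield whose norm is not `1`. -/
def slopes (K : Type*) [Field K] [CharP K 2] (n : ℕ) : Set K :=
  {k | frob K n (frob K n k) = k ∧ k * frob K n k ≠ 1}

omit [IsAlgClosed K] in
theorem one_add_norm_ne_zero {n : ℕ} {k : K} (hk : k ∈ slopes K n) : 1 + k * frob K n k ≠ 0 :=
  fun h => hk.2 (CharTwo.add_eq_zero.1 h).symm

theorem exists_coeff_of_mem_slopes {n : ℕ} {k : K} (hk : k ∈ slopes K n) :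
    ∃ A B, frob K n (frob K n A) = A ∧ frob K n (frob K n B) = B ∧
      A * frob K n A + B * frob K n B = 1 ∧ B = k * A ∧ A ≠ 0 := by
  have h1 := one_add_norm_ne_zero hk
  -- The norm of `A` is forced by `N A + N B = 1`. As `N k` is fixed by `φ`, so is `N A`, which puts
  -- `A` in the quadratic field.
  obtain ⟨A, hA⟩ := exists_mul_frob_eq n (1 + k * frob K n k)⁻¹
  have hA0 : A ≠ 0 := by
    rintro rfl
    simp at hA
    exact h1 hA.symm
  have hφA0 : frob K n A ≠ 0 := by simpa using hA0
  have hA2 : frob K n (frob K n A) = A := by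
    apply mul_left_cancel₀ hφA0
    rw [mul_comm _ A, hA, ← map_mul, hA, map_inv₀, map_add, map_mul, hk.1, map_one,
      mul_comm k]
  refine ⟨A, k * A, hA2, by simp [hA2, hk.1], ?_, rfl, hA0⟩
  rw [map_mul]
  calc _ = A * frob K n A * (1 + k * frob K n k) := by ring
    _ = 1 := by rw [hA, inv_mul_cancel₀ h1]

theorem IsFrame.eval_mcmC_eq_iff {n : ℕ} {l v w : K} (h : IsFrame (frob K n) l v w) (hl : l ≠ 0)
    (y : K) : (mcmC K n).eval y = l * frob K n l ↔
      ∃ k ∈ slopes K n, slopeInvariant (frob K n) v w k = y := by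
  constructor
  · intro hy
    obtain ⟨p, hp⟩ : ∃ p : K, p ^ 2 + p = y := by
      have hdeg : (X ^ 2 + X + C (-y) : K[X]).degree = 2 := by compute_degree!
      obtain ⟨p, hp⟩ := IsAlgClosed.exists_root (X ^ 2 + X + C (-y) : K[X]) (by rw [hdeg]; norm_num)
      refine ⟨p, ?_⟩
      simp [IsRoot] at hp
      linear_combination hp
    obtain ⟨v', w', h', hv'⟩ := exists_frame (n := n) (p := p) hl (by rw [hp, hy])
    have hy' : y = v' * frob K n v' * (w' * frob K n w') := by
      have := h'.norm
      rw [← hp, ← hv']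
      linear_combination (-(v' * frob K n v')) * this
        + (v' * frob K n v') ^ 2 * (CharTwo.two_eq_zero : (2 : K) = 0)
    obtain ⟨A, B, hA, hB, hAB, e1, e2⟩ := h.exists_transform h'
    -- The infinite slope `A = 0` gives the same root as slope `0`, the frame being swapped up to
    -- scalars.
    by_cases hA0 : A = 0
    · refine ⟨0, by simp [slopes], ?_⟩
      rw [slopeInvariant_zero, hy', e1, e2]
      subst hA0
      simp only [map_mul, map_zero, zero_mul, zero_add, add_zero, hB] at hAB ⊢
      linear_combination (-v * frob K n v * (w * frob K n w)) * (B * frob K n B + 1) * hAB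
    · have hφA0 : frob K n A ≠ 0 := by simpa using hA0
      have hk : frob K n (frob K n (B / A)) = B / A := by simp [hA, hB]
      refine ⟨B / A, ⟨hk, fun hc => ?_⟩, ?_⟩
      · rw [map_div₀] at hc
        field_simp at hc
        rw [hc] at hAB
        simp [CharTwo.add_self_eq_zero] at hAB
      · rw [slopeInvariant_eq hA hAB hk (by field_simp), hy', e1, e2]
  · rintro ⟨k, hk, rfl⟩
    obtain ⟨A, B, hA, hB, hAB, hBk, -⟩ := exists_coeff_of_mem_slopes hk
    rw [slopeInvariant_eq hA hAB hk.1 hBk, (h.transform hA hB hAB).eval_mcmC hl]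

/-- Equal invariants mean frames equal up to scaling or swapping; comparing coefficients in the
basis `v`, `w` over the quadratic field yields one alternative each. -/
theorem IsFrame.slopeInvariant_eq_iff {n : ℕ} {l v w : K} (h : IsFrame (frob K n) l v w)
    (hl : l ≠ 0) {k k' : K} (hk : k ∈ slopes K n) (hk' : k' ∈ slopes K n) :
    slopeInvariant (frob K n) v w k' = slopeInvariant (frob K n) v w k ↔
      k' = k ∨ k' * frob K n k = 1 := by
  constructor
  · intro he
    obtain ⟨A, B, hA, hB, hAB, rfl, hA0⟩ := exists_coeff_of_mem_slopes hk
    obtain ⟨A', B', hA', hB', hAB', rfl, hA0'⟩ := exists_coeff_of_mem_slopes hk'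
    rw [slopeInvariant_eq hA hAB hk.1 rfl, slopeInvariant_eq hA' hAB' hk'.1 rfl] at he
    obtain ⟨z, hz, ⟨h1, -⟩ | ⟨h1, -⟩⟩ := (h.transform hA hB hAB).of_invariant_eq
      (h.transform hA' hB' hAB') hl he
    all_goals
      have hz0 : frob K n z ≠ 0 := right_ne_zero_of_mul_eq_one hz
      have hz2 : frob K n (frob K n z) = z := by
        have : frob K n z * frob K n (frob K n z) = 1 := by simpa using congrArg (frob K n) hz
        apply mul_left_cancel₀ hz0
        rw [this, mul_comm, hz]
    · obtain ⟨h2, h3⟩ := h.coeff_eq hl (c := z * A) (d := z * (k * A)) hA' hB' (by simp [hz2, hA])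
        (by simp [hz2, hA, hk.1]) (by linear_combination h1)
      left
      apply mul_right_cancel₀ hA0'
      rw [h3, h2]
      ring
    · obtain ⟨h2, h3⟩ := h.coeff_eq hl (c := z * frob K n (k * A)) (d := z * frob K n A) hA' hB'
        (by simp [hz2, hA, hk.1]) (by simp [hz2, hA]) (by linear_combination h1)
      right
      rw [h2, map_mul] at h3
      have hφA0 : frob K n A ≠ 0 := by simpa using hA0
      have hz1 : z ≠ 0 := left_ne_zero_of_mul_eq_one hz
      apply mul_right_cancel₀ (mul_ne_zero hz1 hφA0)
      linear_combination h3
  · rintro (rfl | h1)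
    · rfl
    · exact slopeInvariant_inv hk.1 h1 hk.2

end Fibre

theorem Set.ncard_eq_mul_of_fiber_ncard {α β : Type*} {S : Set α} {Y : Set β} (f : α → β) (k : ℕ)
    (hS : S.Finite) (hY : Y.Finite) (hf : ∀ x ∈ S, f x ∈ Y)
    (hk : ∀ y ∈ Y, {x ∈ S | f x = y}.ncard = k) : S.ncard = k * Y.ncard := by
  classical
  rw [Set.ncard_eq_toFinset_card S hS, Set.ncard_eq_toFinset_card Y hY,
    Finset.card_eq_sum_card_fiberwise (t := hY.toFinset) (f := f) (by intro x hx; simpa using hf x (by simpa using hx)),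
    Finset.sum_const_nat (m := k), mul_comm]
  intro y hy
  rw [← hk y (by simpa using hy), ← Set.ncard_coe_finset]
  congr 1
  ext x
  simp

/-! ### Counting slopes and fixed slopes -/

section Count

variable {K : Type*} [Field K] [IsAlgClosed K]

theorem ncard_isRoot_of_separable {f : K[X]} (hf : f.Separable) :
    {x | f.IsRoot x}.ncard = f.natDegree := by
  classical
  have h := (card_rootSet_eq_natDegree (K := K) hf (IsAlgClosed.splits _))
  rw [← h, ← Nat.card_eq_fintype_card, Nat.card_coe_set_eq]
  congr 1
  ext x
  rw [mem_rootSet]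
  simp [hf.ne_zero, IsRoot]

theorem ncard_pow_eq {k : ℕ} (hk : (k : K) ≠ 0) {c : K} (hc : c ≠ 0) :
    {x : K | x ^ k = c}.ncard = k := by
  have h := ncard_isRoot_of_separable (separable_X_pow_sub_C c hk hc)
  rw [natDegree_X_pow_sub_C] at h
  simpa [IsRoot, sub_eq_zero] using h

variable [CharP K 2] {n : ℕ}

theorem ncard_frob_eq_add (hn : n ≠ 0) (c : K) : {x : K | frob K n x = x + c}.ncard = 2 ^ n := by
  have h2 : 1 < 2 ^ n := Nat.one_lt_two_pow hn
  have hd : (X ^ 2 ^ n - X - C c : K[X]).natDegree = 2 ^ n := by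
    rw [natDegree_sub_C, natDegree_sub_eq_left_of_natDegree_lt] <;> simp [h2]
  have hs : (X ^ 2 ^ n - X - C c : K[X]).Separable := by
    rw [separable_def]
    have : derivative (X ^ 2 ^ n - X - C c : K[X]) = -1 := by
      have h0 : (2 : K) = 0 := CharTwo.two_eq_zero
      simp [derivative_X_pow, h0, hn]
    rw [this]
    exact isCoprime_one_right.neg_right
  have h := ncard_isRoot_of_separable hs
  rw [hd] at h
  rw [← h]
  congr 1
  ext x
  simp [IsRoot, frob_apply, sub_eq_zero, sub_sub]

theorem ncard_frob_fixed (hn : n ≠ 0) : {x : K | frob K n x = x}.ncard = 2 ^ n := by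
  simpa using ncard_frob_eq_add hn (0 : K)

theorem finite_frob_eq_add (hn : n ≠ 0) (c : K) : {x : K | frob K n x = x + c}.Finite :=
  Set.finite_of_ncard_ne_zero (by rw [ncard_frob_eq_add hn]; positivity)

theorem finite_frob_fixed (hn : n ≠ 0) : {x : K | frob K n x = x}.Finite :=
  Set.finite_of_ncard_ne_zero (by rw [ncard_frob_fixed hn]; positivity)

omit [IsAlgClosed K] in
theorem frob_frob (n m : ℕ) (x : K) : frob K n (frob K m x) = frob K (n + m) x := by
  simp only [frob_apply, ← pow_mul, pow_add, mul_comm]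

theorem ncard_norm_eq (hn : n ≠ 0) {c : K} (hc : c ≠ 0) :
    {x : K | x * frob K n x = c}.ncard = 2 ^ n + 1 := by
  simp_rw [mul_frob]
  refine ncard_pow_eq ?_ hc
  simp [CharTwo.two_eq_zero, hn]

theorem finite_norm_eq (hn : n ≠ 0) {c : K} (hc : c ≠ 0) :
    {x : K | x * frob K n x = c}.Finite :=
  Set.finite_of_ncard_ne_zero (by rw [ncard_norm_eq hn hc]; positivity)

omit [IsAlgClosed K] in
theorem frob_frob_eq_of_norm_eq_one {z : K} (hz : z * frob K n z = 1) :
    frob K n (frob K n z) = z := by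
  have hz0 : frob K n z ≠ 0 := right_ne_zero_of_mul_eq_one hz
  have : frob K n z * frob K n (frob K n z) = 1 := by simpa using congrArg (frob K n) hz
  apply mul_left_cancel₀ hz0
  rw [this, mul_comm, hz]

theorem finite_slopes (hn : n ≠ 0) : (slopes K n).Finite := by
  refine (finite_frob_fixed (K := K) (n := n + n) (by omega)).subset fun k hk => ?_
  rw [Set.mem_ofPred_eq, ← frob_frob, hk.1]

theorem ncard_slopes (hn : n ≠ 0) : (slopes K n).ncard + (2 ^ n + 1) = (2 ^ n) ^ 2 := by
  have h1 : {x : K | frob K (n + n) x = x} = slopes K n ∪ {x : K | x * frob K n x = 1} := by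
    ext x
    simp only [slopes, Set.mem_ofPred_eq, Set.mem_union, ← frob_frob]
    constructor
    · intro h
      by_cases h' : x * frob K n x = 1 <;> simp [h, h']
    · rintro (h | h)
      · exact h.1
      · exact frob_frob_eq_of_norm_eq_one h
  have h2 := ncard_frob_fixed (K := K) (n := n + n) (by omega)
  rw [h1, Set.ncard_union_eq (Set.disjoint_left.2 fun x hx hx' => hx.2 hx')
    (finite_slopes hn) (finite_norm_eq hn one_ne_zero), ncard_norm_eq hn one_ne_zero] at h2
  rw [h2]
  ring

/-- Nonzero slopes pair off as `k`, `1 / φ k`, distinct because `N k ≠ 1`. The slope `0` is left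
alone, its partner being infinite; this is the `+ 1`. -/
theorem IsFrame.two_mul_ncard_image (hn : n ≠ 0) {l v w : K} (h : IsFrame (frob K n) l v w)
    (hl : l ≠ 0) {S : Set K} (hS : S ⊆ slopes K n) (h0 : 0 ∈ S)
    (hinv : ∀ k ∈ S, k ≠ 0 → (frob K n k)⁻¹ ∈ S) :
    2 * (slopeInvariant (frob K n) v w '' S).ncard = S.ncard + 1 := by
  have hSf : S.Finite := (finite_slopes hn).subset hS
  set y := slopeInvariant (frob K n) v w with hy
  have hY : (y '' S).Finite := hSf.image _
  have key : (S \ {0}).ncard = 2 * (y '' S \ {y 0}).ncard := by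
    refine Set.ncard_eq_mul_of_fiber_ncard y 2 (hSf.subset Set.sdiff_subset)
      (hY.subset Set.sdiff_subset) ?_ ?_
    · rintro k ⟨hk, hk0⟩
      refine ⟨⟨k, hk, rfl⟩, fun he => ?_⟩
      rcases (h.slopeInvariant_eq_iff hl (hS h0) (hS hk)).1 he with h1 | h1
      · exact hk0 h1
      · simp at h1
    · rintro _ ⟨⟨k, hk, rfl⟩, hne⟩
      have hk0 : k ≠ 0 := by
        rintro rfl
        simp at hne
      have hφk0 : frob K n k ≠ 0 := by simpa using hk0
      have : {x ∈ S \ {0} | y x = y k} = {k, (frob K n k)⁻¹} := by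
        ext x
        simp only [Set.mem_ofPred_eq, Set.mem_sdiff, Set.mem_singleton_iff, Set.mem_insert_iff]
        constructor
        · rintro ⟨⟨hx, -⟩, he⟩
          exact ((h.slopeInvariant_eq_iff hl (hS hk) (hS hx)).1 he).imp_right
            eq_inv_of_mul_eq_one_left
        · rintro (rfl | rfl)
          · exact ⟨⟨hk, hk0⟩, rfl⟩
          · exact ⟨⟨hinv k hk hk0, by simpa using hk0⟩,
              (h.slopeInvariant_eq_iff hl (hS hk) (hS (hinv k hk hk0))).2
                (Or.inr (inv_mul_cancel₀ hφk0))⟩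
      rw [this, Set.ncard_pair]
      intro he
      apply (hS hk).2
      nth_rewrite 1 [he]
      exact inv_mul_cancel₀ hφk0
  have e1 := Set.ncard_sdiff_singleton_add_one h0 hSf
  have e2 := Set.ncard_sdiff_singleton_add_one (Set.mem_image_of_mem y h0) hY
  omega

/-- The number of roots of `C(x) = a` fixed by the Frobenius endomorphism `x ↦ x ^ (2 ^ N)`. -/
noncomputable def fixedRootCount (n N : ℕ) (a : K) : ℕ :=
  {y : K | (mcmC K n).eval y = a ∧ frob K N y = y}.ncard

/-- A root is rational when its slope `k` is sent to `k` or `1 / φ k`; `hne` excludes the second, so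
rational roots correspond to slopes fixed by `f`. -/
theorem IsFrame.two_mul_fixedRootCount (hn : n ≠ 0) {l v w : K} (h : IsFrame (frob K n) l v w)
    (hl : l ≠ 0) {N : ℕ} (f : K → K) (hf0 : f 0 = 0)
    (hf : ∀ k ∈ slopes K n, f k ∈ slopes K n) (hne : ∀ k ∈ slopes K n, f k * frob K n k ≠ 1)
    (hinv : ∀ k ∈ slopes K n, k ≠ 0 → f k = k → f (frob K n k)⁻¹ = (frob K n k)⁻¹)
    (hF : ∀ k ∈ slopes K n, frob K N (slopeInvariant (frob K n) v w k) =
      slopeInvariant (frob K n) v w (f k)) :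
    2 * fixedRootCount n N (l * frob K n l) = {k ∈ slopes K n | f k = k}.ncard + 1 := by
  rw [← h.two_mul_ncard_image hn hl (S := {k ∈ slopes K n | f k = k}) (fun k hk => hk.1)
    ⟨by simp [slopes], hf0⟩, fixedRootCount]
  · congr 2
    ext y
    rw [Set.mem_ofPred_eq, h.eval_mcmC_eq_iff hl]
    constructor
    · rintro ⟨⟨k, hk, rfl⟩, hy⟩
      rw [hF k hk, h.slopeInvariant_eq_iff hl hk (hf k hk)] at hy
      exact ⟨k, ⟨hk, hy.resolve_right (hne k hk)⟩, rfl⟩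
    · rintro ⟨k, ⟨hk, hfk⟩, rfl⟩
      exact ⟨⟨k, hk, rfl⟩, by rw [hF k hk, hfk]⟩
  · rintro k ⟨hk, hfk⟩ hk0
    have hφk0 : frob K n k ≠ 0 := by simpa using hk0
    refine ⟨⟨by simp [hk.1], fun hc => hk.2 ?_⟩, hinv k hk hk0 hfk⟩
    rw [map_inv₀, hk.1, ← mul_inv, inv_eq_one, mul_comm] at hc
    exact hc

omit [IsAlgClosed K] in
theorem eq_one_of_norm_eq_one {r : K} (hr : r * frob K n r = 1) (hr' : frob K n r = r) :
    r = 1 := by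
  rw [hr', ← sq] at hr
  exact CharTwo.sq_injective (by simpa using hr)

open Classical in
theorem IsFrame.fixedRootCount_of_linear (hn : n ≠ 0) {l v w : K}
    (h : IsFrame (frob K n) l v w) (hl : l ≠ 0) {N : ℕ} {r : K} (hr : r * frob K n r = 1)
    (hF : ∀ k ∈ slopes K n, frob K N (slopeInvariant (frob K n) v w k) =
      slopeInvariant (frob K n) v w (k * r)) :
    2 * fixedRootCount n N (l * frob K n l) = if r = 1 then (2 ^ n) ^ 2 - 2 ^ n else 2 := by
  have hr2 := frob_frob_eq_of_norm_eq_one hr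
  rw [h.two_mul_fixedRootCount hn hl (fun k => k * r) (by simp) _ _ _ hF]
  · split_ifs with h1
    · subst h1
      have := ncard_slopes (K := K) hn
      simp only [mul_one, and_true, Set.ofPred_mem_eq]
      omega
    · have : {k ∈ slopes K n | k * r = k} = {0} := by
        ext k
        simp only [Set.mem_ofPred_eq, Set.mem_singleton_iff]
        constructor
        · rintro ⟨-, hk⟩
          by_contra hk0
          exact h1 ((mul_eq_left₀ hk0).1 hk)
        · rintro rfl
          simp [slopes]
      rw [this]
      simp
  · intro k hk
    refine ⟨by simp [hk.1, hr2], fun hc => hk.2 ?_⟩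
    rw [map_mul] at hc
    linear_combination hc - k * frob K n k * hr
  · intro k hk hc
    -- If `k * r = 1 / φ k`, then `r = 1 / N k` lies in `𝔽_q`; having norm one it equals `1`, so `N
    -- k = 1`.
    have h1 : frob K n r = r := by
      have h2 : frob K n (k * r * frob K n k) = 1 := by rw [hc, map_one]
      have h3 : k * frob K n k * frob K n r = 1 := by
        simp only [map_mul, hk.1] at h2
        linear_combination h2
      have h4 : k * frob K n k ≠ 0 := left_ne_zero_of_mul_eq_one h3
      apply mul_left_cancel₀ h4
      rw [h3, ← hc]
      ring
    rw [eq_one_of_norm_eq_one hr h1, mul_one] at hc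
    exact hk.2 hc
  · intro k _ hk0 hkr
    rw [(mul_eq_left₀ hk0).1 hkr, mul_one]

theorem IsFrame.fixedRootCount_of_semilinear (hn : n ≠ 0) {l v w : K}
    (h : IsFrame (frob K n) l v w) (hl : l ≠ 0) {N : ℕ} {r : K} (hr : r * frob K n r = 1)
    (hF : ∀ k ∈ slopes K n, frob K N (slopeInvariant (frob K n) v w k) =
      slopeInvariant (frob K n) v w (frob K n k * r)) :
    2 * fixedRootCount n N (l * frob K n l) = 2 ^ n := by
  have hr2 := frob_frob_eq_of_norm_eq_one hr
  have hr0 : r ≠ 0 := left_ne_zero_of_mul_eq_one hr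
  rw [h.two_mul_fixedRootCount hn hl (fun k => frob K n k * r) (by simp) _ _ _ hF]
  · obtain ⟨s, hs⟩ := IsAlgClosed.exists_pow_nat_eq r (n := 2) (by norm_num)
    have hsN : s * frob K n s = 1 := by
      apply CharTwo.sq_injective
      simp only [mul_pow, ← map_pow, hs, hr, one_pow]
    have hs0 : s ≠ 0 := left_ne_zero_of_mul_eq_one hsN
    have hφs0 : frob K n s ≠ 0 := right_ne_zero_of_mul_eq_one hsN
    have hs2 := frob_frob_eq_of_norm_eq_one hsN
    -- With `s ^ 2 = r` and `k = s * u`, the fixed-point equation becomes `φ u = u`, and `N k = u ^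
    -- 2` excludes only `u = 1`.
    have : {k ∈ slopes K n | frob K n k * r = k} =
        (fun u => s * u) '' ({u | frob K n u = u} \ {1}) := by
      ext k
      constructor
      · rintro ⟨hk, hkr⟩
        refine ⟨frob K n s * k, ⟨?_, fun hc => hk.2 ?_⟩, ?_⟩
        · rw [Set.mem_ofPred_eq, map_mul, hs2]
          apply mul_left_cancel₀ hs0
          linear_combination hkr + frob K n k * hs - k * hsN
        · rw [Set.mem_singleton_iff] at hc
          have : k = s := by linear_combination s * hc - k * hsN
          rw [this, hsN]
        · linear_combination k * hsN
      · rintro ⟨u, ⟨hu, hu1⟩, rfl⟩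
        rw [Set.mem_ofPred_eq] at hu
        refine ⟨⟨by simp [hu, hs2], fun hc => hu1 ?_⟩, ?_⟩
        · simp only [map_mul, hu] at hc
          apply CharTwo.sq_injective
          linear_combination hc - u ^ 2 * hsN
        · simp only [map_mul, hu]
          linear_combination (-u * frob K n s) * hs + u * s * hsN
    rw [this, Set.ncard_image_of_injective _ (mul_right_injective₀ hs0),
      Set.ncard_sdiff_singleton_add_one (by simp) (finite_frob_fixed hn), ncard_frob_fixed hn]
  · intro k hk
    refine ⟨by simp [hk.1, hr2], fun hc => hk.2 ?_⟩
    rw [map_mul, hk.1] at hc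
    linear_combination hc - k * frob K n k * hr
  · intro k hk hc
    have h1 : frob K n (frob K n k * r * frob K n k) = 1 := by rw [hc, map_one]
    simp only [map_mul, hk.1] at h1
    apply hk.2
    apply CharTwo.sq_injective
    have : (k * frob K n k) ^ 2 * (r * frob K n r) = 1 := by
      linear_combination (k * frob K n r * k) * hc + h1
    rw [hr, mul_one] at this
    simpa using this
  · intro k hk hk0 hkr
    have hφk0 : frob K n k ≠ 0 := by simpa using hk0
    have h2 : k * frob K n r = frob K n k := by
      nth_rewrite 1 [← hkr]
      linear_combination frob K n k * hr
    rw [map_inv₀, hk.1]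
    field_simp
    linear_combination hkr

end Count

/-! ### Action of the `2 ^ N`-power map on slopes -/

section Frobenius

variable {K : Type*} [Field K] [CharP K 2] {n N : ℕ}

theorem map_slopeInvariant_of_straight {v w z u : K} (hz : z * frob K n z = 1)
    (hu : u * frob K n u = 1) (hv : frob K N v = z * v) (hw : frob K N w = u * w) (k : K) :
    frob K N (slopeInvariant (frob K n) v w k) =
      slopeInvariant (frob K n) v w (frob K N k * (u * frob K n z)) := by
  have hz2 := frob_frob_eq_of_norm_eq_one hz
  simp only [slopeInvariant, map_div₀, map_pow, map_mul, map_add, map_one, frob_comm N n, hv, hw,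
    hz2]
  generalize frob K N k = k
  have e1 : z * v + k * (u * w) = z * (v + k * (u * frob K n z) * w) := by
    linear_combination (-k * u * w) * hz
  have e2 : frob K n z * frob K n v + frob K n k * (frob K n u * frob K n w) =
      frob K n z * (frob K n v + frob K n k * (frob K n u * z) * frob K n w) := by
    linear_combination (-frob K n k * frob K n u * frob K n w) * hz
  have e3 : frob K n k * (z * v) + u * w = u * (frob K n k * (frob K n u * z) * v + w) := by
    linear_combination (-frob K n k * z * v) * hu
  have e4 : frob K n (frob K n k) * (frob K n z * frob K n v) + frob K n u * frob K n w =
      frob K n u * (frob K n (frob K n k) * (frob K n (frob K n u) * frob K n z) * frob K n v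
        + frob K n w) := by
    rw [frob_frob_eq_of_norm_eq_one hu]
    linear_combination (-frob K n (frob K n k) * frob K n z * frob K n v) * hu
  rw [e1, e2, e3, e4]
  congr 1
  · generalize v + k * (u * frob K n z) * w = a1
    generalize frob K n v + frob K n k * (frob K n u * z) * frob K n w = a2
    generalize frob K n k * (frob K n u * z) * v + w = a3
    generalize frob K n (frob K n k) * (frob K n (frob K n u) * frob K n z) * frob K n v
        + frob K n w = a4
    linear_combination (a1 * a2 * (a3 * a4) * u * frob K n u) * hz + (a1 * a2 * (a3 * a4)) * hu
  · congr 1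
    linear_combination (-k * frob K n k * u * frob K n u) * hz - (k * frob K n k) * hu

/-- The swap inverts the slope; the identification of `k` with `1 / φ k` undoes the inversion at the
price of a `φ`. -/
theorem map_slopeInvariant_of_twist {v w z u : K} (hz : z * frob K n z = 1)
    (hu : u * frob K n u = 1) (hv : frob K N v = z * w) (hw : frob K N w = u * v) {k : K}
    (hk : frob K n (frob K n k) = k) :
    frob K N (slopeInvariant (frob K n) v w k) =
      slopeInvariant (frob K n) v w (frob K n (frob K N k) * (z * frob K n u)) := by
  have hz2 := frob_frob_eq_of_norm_eq_one hz
  have hu2 := frob_frob_eq_of_norm_eq_one hu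
  have hk2 : frob K n (frob K n (frob K N k)) = frob K N k := by
    rw [frob_comm n N, frob_comm n N, hk]
  simp only [slopeInvariant, map_div₀, map_pow, map_mul, map_add, map_one, frob_comm N n, hv, hw,
    hk, hz2, hu2, hk2]
  generalize frob K N k = k
  congr 1
  · have e1 : z * w + k * (u * v) = u * (v * k + (w * z * frob K n u)) := by
      linear_combination (-z * w) * hu
    have e2 : frob K n z * frob K n w + frob K n k * (frob K n u * frob K n v) =
      frob K n u * (frob K n v * frob K n k + frob K n w * frob K n z * u) := by
      linear_combination (-frob K n z * frob K n w) * hu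
    have e3 : frob K n k * (z * w) + u * v = z * (v * u * frob K n z + w * frob K n k) := by
      linear_combination (-u * v) * hz
    have e4 : k * (frob K n z * frob K n w) + frob K n u * frob K n v =
      frob K n z * (frob K n v * frob K n u * z + frob K n w * k) := by
      linear_combination (-frob K n u * frob K n v) * hz
    rw [e1, e2, e3, e4]
    have f1 : v + frob K n k * (z * frob K n u) * w =
      z * frob K n u * (v * u * frob K n z + w * frob K n k) := by
      linear_combination (-v * z * frob K n z) * hu - v * hz
    have f2 : frob K n v + k * (frob K n z * u) * frob K n w =
      u * frob K n z * (frob K n v * frob K n u * z + frob K n w * k) := by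
      linear_combination (-frob K n v * z * frob K n z) * hu - frob K n v * hz
    have f3 : k * (frob K n z * u) * v + w =
      u * frob K n z * (v * k + (w * z * frob K n u)) := by
      linear_combination (-w * z * frob K n z) * hu - w * hz
    have f4 : frob K n k * (z * frob K n u) * frob K n v + frob K n w =
      z * frob K n u * (frob K n v * frob K n k + frob K n w * frob K n z * u) := by
      linear_combination (-frob K n w * z * frob K n z) * hu - frob K n w * hz
    rw [f1, f2, f3, f4]
    generalize v * k + (w * z * frob K n u) = a1
    generalize frob K n v * frob K n k + frob K n w * frob K n z * u = a2
    generalize v * u * frob K n z + w * frob K n k = a3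
    generalize frob K n v * frob K n u * z + frob K n w * k = a4
    linear_combination (-a1 * a2 * (a3 * a4) * z * frob K n z * u * frob K n u)
      * ((u * frob K n u) * hz + hu)
  · congr 1
    linear_combination (-k * frob K n k * u * frob K n u) * hz - (k * frob K n k) * hu

theorem exists_norm_one_mul {a b : K} (hb : b ≠ 0) (h : a * frob K n a = b * frob K n b) :
    ∃ z, z * frob K n z = 1 ∧ a = z * b := by
  have hφb : frob K n b ≠ 0 := by simpa using hb
  refine ⟨a / b, ?_, by field_simp⟩
  rw [map_div₀]
  field_simp
  exact h

theorem frob_norm (a : K) : frob K N a * frob K n (frob K N a) = frob K N (a * frob K n a) := by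
  rw [map_mul, frob_comm]

theorem frob_mul_of_even {k : K} (m : ℕ) (hk : frob K (n + n) k = k)
    (hm : Even m) : frob K (n * m) k = k := by
  obtain ⟨r, rfl⟩ := hm
  induction r with
  | zero => simp [frob_apply]
  | succ r ih =>
    rw [show n * (r + 1 + (r + 1)) = n * (r + r) + (n + n) by ring, ← frob_frob, hk, ih]

variable [IsAlgClosed K] {p : K}

theorem exists_frame_of_ne (hp : frob K n p ≠ p) : ∃ l v w : K, l ≠ 0 ∧ v ≠ 0 ∧ w ≠ 0 ∧
    IsFrame (frob K n) l v w ∧ (mcmC K n).eval (p ^ 2 + p) = l * frob K n l ∧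
    v * frob K n v = p ∧ w * frob K n w = p + 1 := by
  obtain ⟨l, hl⟩ := exists_mul_frob_eq n ((mcmC K n).eval (p ^ 2 + p))
  have hl0 : l ≠ 0 := by
    rintro rfl
    rw [← eval_mcmC_ne_zero_iff, ← hl] at hp
    simp at hp
  obtain ⟨v, w, h, hv⟩ := exists_frame hl0 hl.symm
  refine ⟨l, v, w, hl0, h.left_ne_zero hl0, h.right_ne_zero hl0, h, hl.symm, hv, ?_⟩
  have := h.norm
  linear_combination this - hv - p * (CharTwo.two_eq_zero : (2 : K) = 0)

open Classical in
theorem fixedRootCount_even_straight (hn : n ≠ 0)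
    (hN : ∀ k : K, frob K n (frob K n k) = k → frob K N k = k) (hp : frob K n p ≠ p)
    (hNp : frob K N p = p) :
    2 * fixedRootCount n N ((mcmC K n).eval (p ^ 2 + p)) =
      if ∃ t, frob K N t = t ∧ t * frob K n t * (p + 1) = p then (2 ^ n) ^ 2 - 2 ^ n else 2 := by
  obtain ⟨l, v, w, hl, hv0, hw0, h, hev, hv, hw⟩ := exists_frame_of_ne hp
  have hφw0 : frob K n w ≠ 0 := by simpa using hw0
  obtain ⟨z, hz, hvz⟩ := exists_norm_one_mul (n := n) (a := frob K N v) hv0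
    (by rw [frob_norm, hv, hNp])
  obtain ⟨u, hu, hwu⟩ := exists_norm_one_mul (n := n) (a := frob K N w) hw0
    (by rw [frob_norm, hw, map_add, hNp, map_one])
  have hz2 := frob_frob_eq_of_norm_eq_one hz
  have hu0 : u ≠ 0 := left_ne_zero_of_mul_eq_one hu
  rw [hev, h.fixedRootCount_of_linear hn hl (N := N) (r := u * frob K n z)]
  · congr 1
    rw [eq_iff_iff]
    -- `z = u` says that `v / w` is rational. Any other solution `t` of the norm equation differs
    -- from `v / w` by a norm-one factor, which is itself rational by `hN`.
    have huz : u * frob K n z = 1 ↔ z = u := by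
      constructor
      · intro h1
        linear_combination u * hz - z * h1
      · rintro rfl
        exact hz
    rw [huz]
    constructor
    · rintro rfl
      refine ⟨v / w, ?_, ?_⟩
      · rw [map_div₀, hvz, hwu]
        field_simp
      · rw [← hv, map_div₀, hv, ← hw]
        field_simp
        exact hv
    · rintro ⟨t, ht, htp⟩
      rw [← hw, ← hv] at htp
      obtain ⟨s, hs, hts⟩ := exists_norm_one_mul (n := n) (a := v) (b := t * w)
        (by rintro h0
            rcases mul_eq_zero.1 h0 with rfl | rfl
            · simp [hv0] at htp
            · exact hw0 rfl)
        (by rw [map_mul]; linear_combination -htp)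
      have hs2 := hN s (frob_frob_eq_of_norm_eq_one hs)
      have := hvz
      rw [hts, map_mul, map_mul, hs2, ht, hwu, ← hts] at this
      apply mul_right_cancel₀ hv0
      rw [← this]
      rw [hts]
      ring
  · rw [map_mul, hz2]
    linear_combination (u * frob K n u) * hz + hu
  · intro k hk
    rw [map_slopeInvariant_of_straight hz hu hvz hwu, hN k hk.1]

theorem fixedRootCount_odd_straight (hn : n ≠ 0)
    (hN : ∀ k : K, frob K n (frob K n k) = k → frob K N k = frob K n k) (hp : frob K n p ≠ p)
    (hNp : frob K N p = p) :
    2 * fixedRootCount n N ((mcmC K n).eval (p ^ 2 + p)) = 2 ^ n := by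
  obtain ⟨l, v, w, hl, hv0, hw0, h, hev, hv, hw⟩ := exists_frame_of_ne hp
  obtain ⟨z, hz, hvz⟩ := exists_norm_one_mul (n := n) (a := frob K N v) hv0
    (by rw [frob_norm, hv, hNp])
  obtain ⟨u, hu, hwu⟩ := exists_norm_one_mul (n := n) (a := frob K N w) hw0
    (by rw [frob_norm, hw, map_add, hNp, map_one])
  have hz2 := frob_frob_eq_of_norm_eq_one hz
  rw [hev, h.fixedRootCount_of_semilinear hn hl (N := N) (r := u * frob K n z)]
  · rw [map_mul, hz2]
    linear_combination (u * frob K n u) * hz + hu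
  · intro k hk
    rw [map_slopeInvariant_of_straight hz hu hvz hwu, hN k hk.1]

theorem fixedRootCount_even_twist (hn : n ≠ 0)
    (hN : ∀ k : K, frob K n (frob K n k) = k → frob K N k = k) (hp : frob K n p ≠ p)
    (hNp : frob K N p = p + 1) :
    2 * fixedRootCount n N ((mcmC K n).eval (p ^ 2 + p)) = 2 ^ n := by
  obtain ⟨l, v, w, hl, hv0, hw0, h, hev, hv, hw⟩ := exists_frame_of_ne hp
  obtain ⟨z, hz, hvz⟩ := exists_norm_one_mul (n := n) (a := frob K N v) hw0
    (by rw [frob_norm, hv, hNp, hw])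
  obtain ⟨u, hu, hwu⟩ := exists_norm_one_mul (n := n) (a := frob K N w) hv0
    (by rw [frob_norm, hw, map_add, hNp, map_one, hv, add_assoc, CharTwo.add_self_eq_zero, add_zero])
  have hu2 := frob_frob_eq_of_norm_eq_one hu
  rw [hev, h.fixedRootCount_of_semilinear hn hl (N := N) (r := z * frob K n u)]
  · rw [map_mul, hu2]
    linear_combination (u * frob K n u) * hz + hu
  · intro k hk
    rw [map_slopeInvariant_of_twist hz hu hvz hwu hk.1, hN k hk.1]

open Classical in
theorem fixedRootCount_odd_twist (hn : n ≠ 0)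
    (hN : ∀ k : K, frob K n (frob K n k) = k → frob K N k = frob K n k) (hp : frob K n p ≠ p)
    (hNp : frob K N p = p + 1) :
    2 * fixedRootCount n N ((mcmC K n).eval (p ^ 2 + p)) =
      if ∃ t, t * frob K N t = 1 ∧ t * frob K n t * (p + 1) = p
      then (2 ^ n) ^ 2 - 2 ^ n else 2 := by
  obtain ⟨l, v, w, hl, hv0, hw0, h, hev, hv, hw⟩ := exists_frame_of_ne hp
  have hφw0 : frob K n w ≠ 0 := by simpa using hw0
  obtain ⟨z, hz, hvz⟩ := exists_norm_one_mul (n := n) (a := frob K N v) hw0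
    (by rw [frob_norm, hv, hNp, hw])
  obtain ⟨u, hu, hwu⟩ := exists_norm_one_mul (n := n) (a := frob K N w) hv0
    (by rw [frob_norm, hw, map_add, hNp, map_one, hv, add_assoc, CharTwo.add_self_eq_zero, add_zero])
  have hu2 := frob_frob_eq_of_norm_eq_one hu
  have hu0 : u ≠ 0 := left_ne_zero_of_mul_eq_one hu
  rw [hev, h.fixedRootCount_of_linear hn hl (N := N) (r := z * frob K n u)]
  · congr 1
    rw [eq_iff_iff]
    -- Here `v / w` is sent to `(z / u) * (w / v)`, so `z = u` says that `t = v / w` satisfies `t *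
    -- frob K N t = 1`.
    have huz : z * frob K n u = 1 ↔ z = u := by
      constructor
      · intro h1
        linear_combination u * h1 - z * hu
      · rintro rfl
        exact hz
    rw [huz]
    constructor
    · rintro rfl
      refine ⟨v / w, ?_, ?_⟩
      · rw [map_div₀, hvz, hwu]
        field_simp
      · rw [← hv, map_div₀, hv, ← hw]
        field_simp
        exact hv
    · rintro ⟨t, ht, htp⟩
      rw [← hw, ← hv] at htp
      have ht0 : t ≠ 0 := left_ne_zero_of_mul_eq_one ht
      obtain ⟨s, hs, hts⟩ := exists_norm_one_mul (n := n) (a := v) (b := t * w)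
        (mul_ne_zero ht0 hw0) (by rw [map_mul]; linear_combination -htp)
      have hs2 := hN s (frob_frob_eq_of_norm_eq_one hs)
      have := hvz
      rw [hts, map_mul, map_mul, hs2, hwu, hts] at this
      apply mul_right_cancel₀ hw0
      linear_combination (-1) * this + (u * w * t * frob K N t) * hs + u * w * ht
  · rw [map_mul, hu2]
    linear_combination (u * frob K n u) * hz + hu
  · intro k hk
    rw [map_slopeInvariant_of_twist hz hu hvz hwu hk.1, hN k hk.1, hk.1]

end Frobenius

/-! ### Counting the points `p` by root count -/

section Global

variable {K : Type*} [Field K] [CharP K 2] {n N : ℕ}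

theorem map_eval_mcmC {F L : Type*} [Field F] [Field L] (f : F →+* L) (n : ℕ) (y : F) :
    f ((mcmC F n).eval y) = (mcmC L n).eval (f y) := by
  simp [mcmC, mcmT, eval_finsetSum]

theorem sq_add_self_eq_iff {p p' : K} : p' ^ 2 + p' = p ^ 2 + p ↔ p' = p ∨ p' = p + 1 := by
  have h4 : (2 : K) = 0 := CharTwo.two_eq_zero
  rw [← sub_eq_zero, ← sub_eq_zero (b := p), ← sub_eq_zero (b := p + 1), ← mul_eq_zero]
  have : p' ^ 2 + p' - (p ^ 2 + p) = (p' - p) * (p' - (p + 1)) := by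
    linear_combination (p' * p - p ^ 2 + p' - p) * h4
  rw [this]

/-- The elements `p` such that `p ^ 2 + p` is a rational point where `C` does not vanish. -/
def goodPoints (K : Type*) [Field K] [CharP K 2] (n N : ℕ) : Set K :=
  {p | (frob K N p = p ∨ frob K N p = p + 1) ∧ frob K n p ≠ p}

/-- The number of rational nonzero `a` for which `C(x) = a` has exactly `i` rational roots. -/
noncomputable def valueCount (K : Type*) [Field K] [CharP K 2] (n N i : ℕ) : ℕ :=
  {a : K | frob K N a = a ∧ a ≠ 0 ∧ fixedRootCount n N a = i}.ncard

variable [IsAlgClosed K]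

theorem finite_goodPoints (hN : N ≠ 0) : (goodPoints K n N).Finite := by
  refine ((finite_frob_fixed hN).union (finite_frob_eq_add hN 1)).subset ?_
  rintro p ⟨hp, -⟩
  exact hp

/-- The map `p ↦ p ^ 2 + p` is two-to-one, and `C` is `i`-to-one over the values with `i` rational
roots. -/
theorem ncard_goodPoints_eq (hN : N ≠ 0) (i : ℕ) :
    {p ∈ goodPoints K n N | fixedRootCount n N ((mcmC K n).eval (p ^ 2 + p)) = i}.ncard =
      2 * (i * valueCount K n N i) := by
  have hfin := finite_goodPoints (K := K) (n := n) hN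
  have hA : {a : K | frob K N a = a ∧ a ≠ 0 ∧ fixedRootCount n N a = i}.Finite :=
    (finite_frob_fixed hN).subset fun a ha => ha.1
  have hX : {y : K | frob K N y = y ∧ (mcmC K n).eval y ≠ 0 ∧
      fixedRootCount n N ((mcmC K n).eval y) = i}.Finite :=
    (finite_frob_fixed hN).subset fun a ha => ha.1
  rw [valueCount, ← Set.ncard_eq_mul_of_fiber_ncard (fun y => (mcmC K n).eval y) i hX hA,
    ← Set.ncard_eq_mul_of_fiber_ncard (fun p => p ^ 2 + p) 2 (hfin.subset (Set.sep_subset _ _)) hX]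
  · rintro p ⟨⟨hp, hp'⟩, hi⟩
    refine ⟨?_, (eval_mcmC_ne_zero_iff p).2 hp', hi⟩
    simp only [map_add, map_pow]
    exact sq_add_self_eq_iff.2 hp
  · rintro y ⟨hy, hy0, hi⟩
    obtain ⟨p, rfl⟩ : ∃ p : K, p ^ 2 + p = y := by
      have hdeg : (X ^ 2 + X + C (-y) : K[X]).degree = 2 := by compute_degree!
      obtain ⟨p, hp⟩ := IsAlgClosed.exists_root (X ^ 2 + X + C (-y) : K[X])
        (by rw [hdeg]; norm_num)
      refine ⟨p, ?_⟩
      simp [IsRoot] at hp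
      linear_combination hp
    have : {x ∈ {p ∈ goodPoints K n N | fixedRootCount n N ((mcmC K n).eval (p ^ 2 + p)) = i} |
        x ^ 2 + x = p ^ 2 + p} = {p, p + 1} := by
      ext x
      simp only [Set.mem_ofPred_eq, sq_add_self_eq_iff, Set.mem_insert_iff, Set.mem_singleton_iff]
      refine ⟨fun h => h.2, fun h => ⟨?_, h⟩⟩
      have hx := sq_add_self_eq_iff.2 h
      rw [hx]
      refine ⟨⟨?_, ?_⟩, hi⟩
      · rw [← sq_add_self_eq_iff, ← map_pow, ← map_add, hx, hy]
      · rw [← eval_mcmC_ne_zero_iff, hx]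
        exact hy0
    rw [this, Set.ncard_pair]
    simp
  · rintro y ⟨hy, hy0, hi⟩
    exact ⟨by rw [map_eval_mcmC, hy], hy0, hi⟩
  · rintro a ⟨ha, ha0, hai⟩
    nth_rewrite 2 [← hai]
    rw [fixedRootCount]
    congr 1
    ext y
    simp only [Set.mem_ofPred_eq]
    constructor
    · rintro ⟨h1, h2⟩
      exact ⟨h2, h1.1⟩
    · rintro ⟨h1, h2⟩
      exact ⟨⟨h2, by rw [h1]; exact ha0, by rw [h1, hai]⟩, h1⟩

/-- The counts determined by a splitting of the good points into those of unipotent type `U` and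
those of torus type `V`, where `R` selects the points of `V` with trivial Frobenius. -/
theorem valueCount_of_split (hn : n ≠ 0) (hN : N ≠ 0) {h : ℕ} (hq : 2 ^ n = 2 * h) (hh : 2 ≤ h)
    {U V : Set K} (hUV : goodPoints K n N = U ∪ V) (R : K → Prop)
    (hU : ∀ p ∈ U, 2 * fixedRootCount n N ((mcmC K n).eval (p ^ 2 + p)) = 2 ^ n)
    (hV : ∀ p ∈ V, (∃ t, R t ∧ t * frob K n t * (p + 1) = p) →
      2 * fixedRootCount n N ((mcmC K n).eval (p ^ 2 + p)) = (2 ^ n) ^ 2 - 2 ^ n)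
    (hV' : ∀ p ∈ V, (¬ ∃ t, R t ∧ t * frob K n t * (p + 1) = p) →
      2 * fixedRootCount n N ((mcmC K n).eval (p ^ 2 + p)) = 2)
    (hR : ∀ t, R t → frob K n (frob K n t) ≠ t →
      t * frob K n t / (t * frob K n t + 1) ∈ V)
    (hR' : ∀ t s, R t → s * frob K n s = 1 → R (s * t)) (hRf : {t | R t}.Finite) :
    2 * h * valueCount K n N h = U.ncard ∧
    2 * valueCount K n N 1 + 2 * h * (2 * h - 1) * valueCount K n N (h * (2 * h - 1)) = V.ncard ∧
    (2 * h + 1) * (2 * h * (2 * h - 1) * valueCount K n N (h * (2 * h - 1))) =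
      {t : K | R t ∧ frob K n (frob K n t) ≠ t}.ncard ∧
    valueCount K n N 0 + valueCount K n N 1 + valueCount K n N h +
      valueCount K n N (h * (2 * h - 1)) + 1 = 2 ^ N ∧
    ∀ a : K, frob K N a = a → a ≠ 0 → fixedRootCount n N a = 0 ∨ fixedRootCount n N a = 1 ∨
      fixedRootCount n N a = h ∨ fixedRootCount n N a = h * (2 * h - 1) := by
  set e : K → ℕ := fun p => fixedRootCount n N ((mcmC K n).eval (p ^ 2 + p)) with he
  obtain ⟨f, hf⟩ : ∃ f, f = h * (2 * h - 1) := ⟨_, rfl⟩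
  have hf2 : 2 * h * (2 * h - 1) = 2 * f := by rw [hf]; ring
  -- With `2 ≤ h` this makes `0`, `1`, `h` and `f` distinct, so root counts separate the types of
  -- points.
  have hfh : h < f := by
    rw [hf]
    calc h = h * 1 := (mul_one h).symm
      _ < h * (2 * h - 1) := by
        apply Nat.mul_lt_mul_of_pos_left <;> omega
  have hqq : (2 ^ n) ^ 2 - 2 ^ n = 2 * f := by
    rw [hq, ← hf2, Nat.mul_sub, mul_one, sq]
  rw [hf2, ← hf]
  have hU : ∀ p ∈ U, e p = h := fun p hp => by have := hU p hp; simp only [he]; omega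
  have hV : ∀ p ∈ V, (∃ t, R t ∧ t * frob K n t * (p + 1) = p) → e p = f :=
    fun p hp ht => by have := hV p hp ht; simp only [he]; omega
  have hV' : ∀ p ∈ V, (¬ ∃ t, R t ∧ t * frob K n t * (p + 1) = p) → e p = 1 :=
    fun p hp ht => by have := hV' p hp ht; simp only [he]; omega
  have hfin := finite_goodPoints (K := K) (n := n) hN
  have hVG : V ⊆ goodPoints K n N := hUV ▸ Set.subset_union_right
  have c (i : ℕ) : {p ∈ goodPoints K n N | e p = i}.ncard =
    2 * (i * valueCount K n N i) := ncard_goodPoints_eq hN i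
  have eh : {p ∈ goodPoints K n N | e p = h} = U := by
    ext p
    rw [hUV]
    constructor
    · rintro ⟨hp | hp, hpe⟩
      · exact hp
      · by_cases ht : ∃ t, R t ∧ t * frob K n t * (p + 1) = p
        · have := hV p hp ht
          omega
        · have := hV' p hp ht
          omega
    · exact fun hp => ⟨Or.inl hp, hU p hp⟩
  have e1 : {p ∈ goodPoints K n N | e p = 1} ∪ {p ∈ goodPoints K n N | e p = f} = V := by
    ext p
    rw [hUV]
    constructor
    · rintro (⟨hp | hp, hpe⟩ | ⟨hp | hp, hpe⟩)
      · have := hU p hp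
        omega
      · exact hp
      · have := hU p hp
        omega
      · exact hp
    · intro hp
      by_cases ht : ∃ t, R t ∧ t * frob K n t * (p + 1) = p
      · exact Or.inr ⟨Or.inr hp, hV p hp ht⟩
      · exact Or.inl ⟨Or.inr hp, hV' p hp ht⟩
  have ef : ∀ p, p ∈ {p ∈ goodPoints K n N | e p = f} ↔
      p ∈ V ∧ ∃ t, R t ∧ t * frob K n t * (p + 1) = p := by
    intro p
    constructor
    · intro hp
      have hpV : p ∈ V := e1 ▸ Or.inr hp
      refine ⟨hpV, ?_⟩
      by_contra ht
      have := hV' p hpV ht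
      have := hp.2
      omega
    · rintro ⟨hp, ht⟩
      exact ⟨hVG hp, hV p hp ht⟩
  have t1 := c h
  have t2 := c 1
  have t3 := c f
  have t4 := congrArg Set.ncard e1
  rw [Set.ncard_union_eq (Set.disjoint_left.2 fun x hx hx' => by
    have := hx.2
    have := hx'.2
    omega) (hfin.subset (Set.sep_subset _ _)) (hfin.subset (Set.sep_subset _ _)), t2, t3] at t4
  have hval : ∀ a : K, frob K N a = a → a ≠ 0 → fixedRootCount n N a = 0 ∨
      fixedRootCount n N a = 1 ∨ fixedRootCount n N a = h ∨ fixedRootCount n N a = f := by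
    intro a ha ha0
    by_cases h0 : fixedRootCount n N a = 0
    · exact Or.inl h0
    right
    obtain ⟨y, rfl, hy⟩ := Set.nonempty_of_ncard_ne_zero h0
    obtain ⟨p, rfl⟩ : ∃ p : K, p ^ 2 + p = y := by
      have hdeg : (X ^ 2 + X + C (-y) : K[X]).degree = 2 := by compute_degree!
      obtain ⟨p, hp⟩ := IsAlgClosed.exists_root (X ^ 2 + X + C (-y) : K[X])
        (by rw [hdeg]; norm_num)
      refine ⟨p, ?_⟩
      simp [IsRoot] at hp
      linear_combination hp
    have hp : p ∈ goodPoints K n N :=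
      ⟨by rw [← sq_add_self_eq_iff, ← map_pow, ← map_add, hy], (eval_mcmC_ne_zero_iff p).1 ha0⟩
    rw [hUV] at hp
    change e p = 1 ∨ e p = h ∨ e p = f
    rcases hp with hp | hp
    · exact Or.inr (Or.inl (hU p hp))
    · by_cases ht : ∃ t, R t ∧ t * frob K n t * (p + 1) = p
      · exact Or.inr (Or.inr (hV p hp ht))
      · exact Or.inl (hV' p hp ht)
  refine ⟨?_, ?_, ?_, ?_, hval⟩
  · rw [← eh, t1]
    ring
  · linarith
  -- The map `t ↦ N t / (N t + 1)` onto the points with `f` roots has fibres `N s = p / (p + 1)` of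
  -- size `q + 1`. They stay in `R` by `hR'`, and avoid `𝔽_{q²}` because `p` is not in `𝔽_q`.
  · rw [mul_assoc 2 f, ← t3, ← hq]
    symm
    refine Set.ncard_eq_mul_of_fiber_ncard (fun t => t * frob K n t / (t * frob K n t + 1)) _
      (hRf.subset fun t ht => ht.1) (hfin.subset (Set.sep_subset _ _)) ?_ ?_
    · rintro t ⟨ht, ht'⟩
      rw [ef]
      refine ⟨hR t ht ht', t, ht, ?_⟩
      have hN1 : t * frob K n t + 1 ≠ 0 := fun h0 =>
        ht' (frob_frob_eq_of_norm_eq_one (CharTwo.add_eq_zero.1 h0))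
      field_simp
      linear_combination (t * frob K n t) ^ 2 * (CharTwo.two_eq_zero : (2 : K) = 0)
    · intro p hp
      obtain ⟨hpV, t, ht, htp⟩ := (ef p).1 hp
      have hpG := hVG hpV
      have hp1 : p + 1 ≠ 0 := fun h0 => by
        have : p = 1 := CharTwo.add_eq_zero.1 h0
        exact hpG.2 (by simp [this])
      have hp0 : p ≠ 0 := by
        rintro rfl
        exact hpG.2 (by simp)
      have ht0 : t ≠ 0 := by
        rintro rfl
        simp at htp
        exact hp0 htp.symm
      rw [← ncard_norm_eq (K := K) hn (div_ne_zero hp0 hp1)]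
      congr 1
      ext s
      simp only [Set.mem_ofPred_eq, eq_div_iff hp1]
      have hs : s * frob K n s * (p + 1) = p → s * frob K n s + 1 ≠ 0 := by
        intro h1 h2
        rw [CharTwo.add_eq_zero.1 h2] at h1
        simp at h1
      constructor
      · rintro ⟨⟨hs1, hs2⟩, hs3⟩
        have hN1 : s * frob K n s + 1 ≠ 0 := fun h0 =>
          hs2 (frob_frob_eq_of_norm_eq_one (CharTwo.add_eq_zero.1 h0))
        rw [div_eq_iff hN1] at hs3
        linear_combination hs3 + (p * (s * frob K n s)) * (CharTwo.two_eq_zero : (2 : K) = 0)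
      · intro h1
        have hN1 := hs h1
        refine ⟨⟨?_, ?_⟩, ?_⟩
        · obtain ⟨z, hz, rfl⟩ := exists_norm_one_mul (n := n) (a := s) ht0
            (mul_right_cancel₀ hp1 (h1.trans htp.symm))
          exact hR' t z ht hz
        · intro h2
          have h3 : frob K n (s * frob K n s) = s * frob K n s := by
            rw [map_mul, h2, mul_comm]
          have h4 : s * frob K n s * (frob K n p + 1) = frob K n p := by
            have := congrArg (frob K n) h1
            rwa [map_mul, h3, map_add, map_one] at this
          apply hpG.2
          apply mul_left_cancel₀ hN1
          linear_combination h4 - h1 + (frob K n p - p) * (CharTwo.two_eq_zero : (2 : K) = 0)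
        · rw [div_eq_iff hN1]
          linear_combination h1 - (p * (s * frob K n s)) * (CharTwo.two_eq_zero : (2 : K) = 0)
  · have hA : ∀ i, {a : K | frob K N a = a ∧ a ≠ 0 ∧ fixedRootCount n N a = i}.Finite :=
      fun i => (finite_frob_fixed hN).subset fun a ha => ha.1
    have hU4 : {a : K | frob K N a = a} \ {0} =
        (({a : K | frob K N a = a ∧ a ≠ 0 ∧ fixedRootCount n N a = 0} ∪
        {a : K | frob K N a = a ∧ a ≠ 0 ∧ fixedRootCount n N a = 1}) ∪
        {a : K | frob K N a = a ∧ a ≠ 0 ∧ fixedRootCount n N a = h}) ∪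
        {a : K | frob K N a = a ∧ a ≠ 0 ∧ fixedRootCount n N a = f} := by
      ext a
      simp only [Set.mem_sdiff, Set.mem_ofPred_eq, Set.mem_singleton_iff, Set.mem_union]
      constructor
      · rintro ⟨ha, ha0⟩
        rcases hval a ha ha0 with h1 | h1 | h1 | h1
        · exact Or.inl (Or.inl (Or.inl ⟨ha, ha0, h1⟩))
        · exact Or.inl (Or.inl (Or.inr ⟨ha, ha0, h1⟩))
        · exact Or.inl (Or.inr ⟨ha, ha0, h1⟩)
        · exact Or.inr ⟨ha, ha0, h1⟩
      · rintro (((h1 | h1) | h1) | h1) <;> exact ⟨h1.1, h1.2.1⟩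
    have h1 := Set.ncard_sdiff_singleton_add_one (a := (0 : K)) (s := {a : K | frob K N a = a})
      (by simp) (finite_frob_fixed hN)
    rw [ncard_frob_fixed hN, hU4, Set.ncard_union_eq _ (((hA _).union (hA _)).union (hA _)) (hA _),
      Set.ncard_union_eq _ ((hA _).union (hA _)) (hA _), Set.ncard_union_eq _ (hA _) (hA _)] at h1
    · exact h1
    · refine Set.disjoint_left.2 ?_
      rintro a ⟨-, -, h1⟩ ⟨-, -, h2⟩
      omega
    · refine Set.disjoint_left.2 ?_
      rintro a (⟨-, -, h1⟩ | ⟨-, -, h1⟩) ⟨-, -, h2⟩ <;> omega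
    · refine Set.disjoint_left.2 ?_
      rintro a ((⟨-, -, h1⟩ | ⟨-, -, h1⟩) | ⟨-, -, h1⟩) ⟨-, -, h2⟩ <;> omega

end Global

/-! ### The linear equations for even and odd `m` -/

section Parity

variable {K : Type*} [Field K] [CharP K 2] {n m : ℕ}

theorem frob_mul_of_odd {k : K} (hk : frob K n (frob K n k) = k) (hm : Odd m) :
    frob K (n * m) k = frob K n k := by
  obtain ⟨r, rfl⟩ := hm
  rw [show n * (2 * r + 1) = n * (r + r) + n by ring, ← frob_frob, frob_comm,
    frob_mul_of_even (r + r) (by rw [← frob_frob, hk]) ⟨r, rfl⟩]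

theorem frob_mul_of_fixed {k : K} (hk : frob K n k = k) (m : ℕ) : frob K (n * m) k = k := by
  induction m with
  | zero => simp [frob_apply]
  | succ m ih => rw [mul_add, mul_one, ← frob_frob, hk, ih]

variable [IsAlgClosed K]

theorem ncard_straight (hn : n ≠ 0) (hm : m ≠ 0) :
    {p : K | frob K (n * m) p = p ∧ frob K n p ≠ p}.ncard + 2 ^ n = 2 ^ (n * m) := by
  have h : {p : K | frob K n p = p} ⊆ {p : K | frob K (n * m) p = p} :=
    fun p hp => frob_mul_of_fixed hp m
  rw [← ncard_frob_fixed (K := K) hn, ← ncard_frob_fixed (K := K) (mul_ne_zero hn hm),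
    ← Set.ncard_sdiff_add_ncard_of_subset h (finite_frob_fixed (mul_ne_zero hn hm))]
  rfl

theorem ncard_twist (hn : n ≠ 0) (hm : m ≠ 0) :
    {p : K | frob K (n * m) p = p + 1 ∧ frob K n p ≠ p}.ncard = 2 ^ (n * m) := by
  rw [← ncard_frob_eq_add (mul_ne_zero hn hm) (1 : K)]
  congr 1
  ext p
  simp only [Set.mem_ofPred_eq, and_iff_left_iff_imp]
  intro h1 h2
  rw [frob_mul_of_fixed h2] at h1
  simp at h1

omit [IsAlgClosed K] in
theorem goodPoints_eq_union (n N : ℕ) : goodPoints K n N =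
    {p : K | frob K N p = p ∧ frob K n p ≠ p} ∪ {p : K | frob K N p = p + 1 ∧ frob K n p ≠ p} := by
  ext p
  simp only [goodPoints, Set.mem_ofPred_eq, Set.mem_union]
  tauto

omit [IsAlgClosed K] in
theorem frob_div_ne {t : K} (ht : frob K n (frob K n t) ≠ t) :
    frob K n (t * frob K n t / (t * frob K n t + 1)) ≠ t * frob K n t / (t * frob K n t + 1) := by
  have h4 : (2 : K) = 0 := CharTwo.two_eq_zero
  have hN1 : t * frob K n t + 1 ≠ 0 := fun h0 =>
    ht (frob_frob_eq_of_norm_eq_one (CharTwo.add_eq_zero.1 h0))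
  have hN2 : frob K n (t * frob K n t) + 1 ≠ 0 := by
    have : frob K n (t * frob K n t + 1) ≠ 0 := by simpa only [ne_eq, map_eq_zero] using hN1
    rwa [map_add, map_one] at this
  intro h
  rw [map_div₀, map_add, map_one, div_eq_div_iff hN2 hN1] at h
  have h5 : frob K n (t * frob K n t) = t * frob K n t := by linear_combination h
  rw [map_mul, mul_comm] at h5
  have ht0 : frob K n t ≠ 0 := fun h0 => ht (by rw [h0, map_zero, (map_eq_zero _).1 h0])
  exact ht (mul_right_cancel₀ ht0 h5)

/-- For even `m` the `q ^ m`-power map is trivial on `𝔽_{q²}`, so points with `p ↦ p + 1` are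
unipotent and rational ones toral; the relevant `t` form `𝔽_{q^m}` minus `𝔽_{q²}`. -/
theorem valueCount_even (hn : n ≠ 0) (hm : m ≠ 0) (hme : Even m) {h : ℕ} (hq : 2 ^ n = 2 * h)
    (hh : 2 ≤ h) :
    2 * h * valueCount K n (n * m) h = 2 ^ (n * m) ∧
    2 * valueCount K n (n * m) 1 +
      2 * h * (2 * h - 1) * valueCount K n (n * m) (h * (2 * h - 1)) + 2 ^ n = 2 ^ (n * m) ∧
    (2 * h + 1) * (2 * h * (2 * h - 1) * valueCount K n (n * m) (h * (2 * h - 1))) + (2 ^ n) ^ 2 =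
      2 ^ (n * m) ∧
    valueCount K n (n * m) 0 + valueCount K n (n * m) 1 + valueCount K n (n * m) h +
      valueCount K n (n * m) (h * (2 * h - 1)) + 1 = 2 ^ (n * m) ∧
    ∀ a : K, frob K (n * m) a = a → a ≠ 0 → fixedRootCount n (n * m) a = 0 ∨
      fixedRootCount n (n * m) a = 1 ∨ fixedRootCount n (n * m) a = h ∨
      fixedRootCount n (n * m) a = h * (2 * h - 1) := by
  have hN : ∀ k : K, frob K n (frob K n k) = k → frob K (n * m) k = k :=
    fun k hk => frob_mul_of_even m (by rw [← frob_frob, hk]) hme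
  obtain ⟨h1, h2, h3, h4⟩ := valueCount_of_split (K := K) hn (mul_ne_zero hn hm) hq hh
    ((goodPoints_eq_union n (n * m)).trans (Set.union_comm _ _)) (fun t => frob K (n * m) t = t)
    (fun p hp => fixedRootCount_even_twist hn hN hp.2 hp.1)
    (fun p hp ht => by rw [fixedRootCount_even_straight hn hN hp.2 hp.1, if_pos ht])
    (fun p hp ht => by rw [fixedRootCount_even_straight hn hN hp.2 hp.1, if_neg ht])
    (fun t ht ht2 => ⟨by simp only [map_div₀, map_mul, map_add, map_one, frob_comm (n * m) n, ht],
      frob_div_ne ht2⟩)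
    (fun t s ht hs => by rw [map_mul, ht, hN s (frob_frob_eq_of_norm_eq_one hs)])
    (finite_frob_fixed (mul_ne_zero hn hm))
  refine ⟨by rw [h1, ncard_twist hn hm], by rw [h2, ncard_straight hn hm], ?_, h4⟩
  have hsub : {t : K | frob K (n + n) t = t} ⊆ {t : K | frob K (n * m) t = t} :=
    fun t ht => hN t (by rw [frob_frob]; exact ht)
  have := Set.ncard_sdiff_add_ncard_of_subset hsub (finite_frob_fixed (mul_ne_zero hn hm))
  rw [ncard_frob_fixed (mul_ne_zero hn hm), ncard_frob_fixed (by omega)] at this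
  rw [h3, ← this, ← pow_mul, mul_two]
  simp_rw [frob_frob]
  rfl

/-- For odd `m` the `q ^ m`-power map is `φ` on `𝔽_{q²}`, so the two types trade places; the
relevant `t` are the `q ^ m + 1` solutions of `t ^ (q ^ m + 1) = 1` minus the `q + 1` elements with
`N t = 1`. -/
theorem valueCount_odd (hn : n ≠ 0) (hm : Odd m) {h : ℕ} (hq : 2 ^ n = 2 * h)
    (hh : 2 ≤ h) :
    2 * h * valueCount K n (n * m) h + 2 ^ n = 2 ^ (n * m) ∧
    2 * valueCount K n (n * m) 1 +
      2 * h * (2 * h - 1) * valueCount K n (n * m) (h * (2 * h - 1)) = 2 ^ (n * m) ∧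
    (2 * h + 1) * (2 * h * (2 * h - 1) * valueCount K n (n * m) (h * (2 * h - 1))) + 2 ^ n =
      2 ^ (n * m) ∧
    valueCount K n (n * m) 0 + valueCount K n (n * m) 1 + valueCount K n (n * m) h +
      valueCount K n (n * m) (h * (2 * h - 1)) + 1 = 2 ^ (n * m) ∧
    ∀ a : K, frob K (n * m) a = a → a ≠ 0 → fixedRootCount n (n * m) a = 0 ∨
      fixedRootCount n (n * m) a = 1 ∨ fixedRootCount n (n * m) a = h ∨
      fixedRootCount n (n * m) a = h * (2 * h - 1) := by
  have hm0 : m ≠ 0 := by rintro rfl; simp at hm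
  have hN : ∀ k : K, frob K n (frob K n k) = k → frob K (n * m) k = frob K n k :=
    fun k hk => frob_mul_of_odd hk hm
  have h40 : (2 : K) = 0 := CharTwo.two_eq_zero
  have hfin : {t : K | t * frob K (n * m) t = 1}.Finite :=
    finite_norm_eq (mul_ne_zero hn hm0) one_ne_zero
  obtain ⟨h1, h2, h3, h4⟩ := valueCount_of_split (K := K) hn (mul_ne_zero hn hm0) hq hh
    (goodPoints_eq_union n (n * m)) (fun t => t * frob K (n * m) t = 1)
    (fun p hp => fixedRootCount_odd_straight hn hN hp.2 hp.1)
    (fun p hp ht => by rw [fixedRootCount_odd_twist hn hN hp.2 hp.1, if_pos ht])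
    (fun p hp ht => by rw [fixedRootCount_odd_twist hn hN hp.2 hp.1, if_neg ht])
    (fun t ht ht2 => by
      refine ⟨?_, frob_div_ne ht2⟩
      have hN1 : t * frob K n t + 1 ≠ 0 := fun h0 =>
        ht2 (frob_frob_eq_of_norm_eq_one (CharTwo.add_eq_zero.1 h0))
      have hN2 : frob K (n * m) (t * frob K n t + 1) ≠ 0 := by
        simpa only [ne_eq, map_eq_zero] using hN1
      have e : t * frob K n t * frob K (n * m) (t * frob K n t) = 1 := by
        have := congrArg (frob K n) ht
        rw [map_mul, map_one] at this
        rw [map_mul, frob_comm (n * m) n]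
        linear_combination (frob K n t * frob K n (frob K (n * m) t)) * ht + this
      rw [map_add, map_one] at hN2
      rw [map_div₀, map_add, map_one]
      generalize frob K (n * m) (t * frob K n t) = b at *
      generalize t * frob K n t = a at *
      field_simp
      linear_combination (-1) * e - (1 + a) * h40)
    (fun t s ht hs => by
      rw [map_mul, hN s (frob_frob_eq_of_norm_eq_one hs)]
      linear_combination (s * frob K n s) * ht + hs)
    hfin
  refine ⟨by rw [h1, ncard_straight hn hm0], by rw [h2, ncard_twist hn hm0], ?_, h4⟩
  have hsub : {t : K | t * frob K n t = 1} ⊆ {t : K | t * frob K (n * m) t = 1} := fun t ht => by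
    rw [Set.mem_ofPred_eq, hN t (frob_frob_eq_of_norm_eq_one ht)]
    exact ht
  have := Set.ncard_sdiff_add_ncard_of_subset hsub hfin
  rw [ncard_norm_eq (mul_ne_zero hn hm0) one_ne_zero, ncard_norm_eq hn one_ne_zero,
    ← add_assoc, add_left_inj] at this
  rw [h3, ← this]
  congr 2
  ext t
  simp only [Set.mem_ofPred_eq, Set.mem_sdiff]
  refine and_congr_right fun ht => not_congr ⟨fun h => ?_, frob_frob_eq_of_norm_eq_one⟩
  rw [← hN t h]
  exact ht

end Parity

/-! ### Passing from `F` to its algebraic closure -/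

section Transfer

variable {F : Type*} [Field F] [Finite F] {K : Type*} [Field K] [CharP K 2]
  [IsAlgClosed K] (f : F →+* K) {n N : ℕ}

theorem range_eq_frob_fixed (hN : N ≠ 0) (hF : Nat.card F = 2 ^ N) :
    Set.range f = {y | frob K N y = y} := by
  refine Set.eq_of_subset_of_ncard_le ?_ ?_ (finite_frob_fixed hN)
  · rintro _ ⟨x, rfl⟩
    have := Fintype.ofFinite F
    rw [Set.mem_ofPred_eq, frob_apply, ← map_pow, ← hF, Nat.card_eq_fintype_card,
      FiniteField.pow_card]
  · rw [ncard_frob_fixed hN, ← hF, ← Nat.card_coe_set_eq]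
    exact (Nat.card_range_of_injective f.injective).ge

variable [CharP F 2]

theorem numRoots_eq (hN : N ≠ 0) (hF : Nat.card F = 2 ^ N) (a : F) :
    numRoots n a = fixedRootCount n N (f a) := by
  rw [numRoots, fixedRootCount, ← Set.ncard_image_of_injective _ f.injective]
  congr 1
  ext y
  have hy : frob K N y = y ↔ y ∈ Set.range f := by rw [range_eq_frob_fixed f hN hF]; rfl
  have key (x : F) : (mcmC F n + C a).IsRoot x ↔ (mcmC K n).eval (f x) = f a := by
    rw [← map_eval_mcmC, f.injective.eq_iff, IsRoot, eval_add, eval_C, CharTwo.add_eq_zero]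
  simp only [Set.mem_image, Set.mem_ofPred_eq, hy, key]
  constructor
  · rintro ⟨x, hx, rfl⟩
    exact ⟨hx, x, rfl⟩
  · rintro ⟨hx, x, rfl⟩
    exact ⟨x, hx, rfl⟩

include f in
theorem rootCount_eq (hN : N ≠ 0) (hF : Nat.card F = 2 ^ N) (i : ℕ) :
    rootCount F n i = valueCount K n N i := by
  rw [rootCount, valueCount, ← Set.ncard_image_of_injective _ f.injective]
  congr 1
  ext y
  have hy : frob K N y = y ↔ y ∈ Set.range f := by rw [range_eq_frob_fixed f hN hF]; rfl
  simp only [Set.mem_image, Set.mem_ofPred_eq, hy, numRoots_eq f hN hF]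
  constructor
  · rintro ⟨x, ⟨hx, hi⟩, rfl⟩
    exact ⟨⟨x, rfl⟩, by simpa using hx, hi⟩
  · rintro ⟨⟨x, rfl⟩, hx, hi⟩
    exact ⟨x, ⟨by simpa using hx, hi⟩, rfl⟩

end Transfer

/-! ### Solving the linear equations -/

theorem corollary6p4 (n m q : ℕ) (hn : 1 < n) (hm : 1 ≤ m) (hq : q = 2 ^ n)
    (F : Type*) [Field F] [Finite F] (hF : Nat.card F = q ^ m) :
    (∀ a : F, a ≠ 0 →
      numRoots n a = 0 ∨ numRoots n a = 1 ∨ numRoots n a = q / 2 ∨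
        numRoots n a = (q / 2) * (q - 1)) ∧
    (Even m →
      (rootCount F n 0 : ℚ) = ((q : ℚ) - 2) * ((q : ℚ) ^ m - 1) / (2 * ((q : ℚ) - 1)) ∧
      (rootCount F n 1 : ℚ) = ((q : ℚ) ^ (m + 1) - q) / (2 * ((q : ℚ) + 1)) ∧
      (rootCount F n (q / 2) : ℚ) = (q : ℚ) ^ (m - 1) ∧
      (rootCount F n ((q / 2) * (q - 1)) : ℚ) =
        ((q : ℚ) ^ (m - 1) - q) / ((q : ℚ) ^ 2 - 1)) ∧
    (Odd m →
      (rootCount F n 0 : ℚ) = ((q : ℚ) - 2) * ((q : ℚ) ^ m - 1) / (2 * ((q : ℚ) - 1)) ∧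
      (rootCount F n 1 : ℚ) = ((q : ℚ) ^ (m + 1) + q) / (2 * ((q : ℚ) + 1)) ∧
      (rootCount F n (q / 2) : ℚ) = (q : ℚ) ^ (m - 1) - 1 ∧
      (rootCount F n ((q / 2) * (q - 1)) : ℚ) =
        ((q : ℚ) ^ (m - 1) - 1) / ((q : ℚ) ^ 2 - 1)) := by
  have hn0 : n ≠ 0 := by omega
  have hm0 : m ≠ 0 := by omega
  have hN0 : n * m ≠ 0 := mul_ne_zero hn0 hm0
  have hF' : Nat.card F = 2 ^ (n * m) := by rw [hF, hq, pow_mul]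
  have hchar : CharP F 2 := by
    have := Fintype.ofFinite F
    obtain ⟨p, hp⟩ := CharP.exists F
    obtain ⟨k, hpp, hk⟩ := FiniteField.card F p
    rw [← Nat.card_eq_fintype_card, hF'] at hk
    have : p ∣ 2 ^ (n * m) := hk ▸ dvd_pow_self p k.ne_zero
    rwa [← (Nat.prime_dvd_prime_iff_eq hpp Nat.prime_two).1 (hpp.dvd_of_dvd_pow this)]
  have hcharK : CharP (AlgebraicClosure F) 2 :=
    charP_of_injective_algebraMap (algebraMap F (AlgebraicClosure F)).injective 2
  obtain ⟨h, hh⟩ : ∃ h, 2 ^ n = 2 * h := dvd_pow_self 2 hn0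
  have hh2 : 2 ≤ h := by
    have : 2 ^ 2 ≤ 2 ^ n := Nat.pow_le_pow_right (by norm_num) hn
    omega
  have hqh : q = 2 * h := hq.trans hh
  have hq2 : q / 2 = h := by omega
  have hqm : 2 ^ (n * m) = q ^ m := by rw [pow_mul, hq]
  obtain ⟨k, rfl⟩ : ∃ k, m = k + 1 := ⟨m - 1, by omega⟩
  rw [hq2]
  simp only [rootCount_eq (algebraMap F (AlgebraicClosure F)) hN0 hF',
    numRoots_eq (algebraMap F (AlgebraicClosure F)) hN0 hF']
  have hfix (a : F) : frob (AlgebraicClosure F) (n * (k + 1)) (algebraMap F _ a) =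
      algebraMap F _ a := by
    have : algebraMap F (AlgebraicClosure F) a ∈ Set.range (algebraMap F (AlgebraicClosure F)) :=
      ⟨a, rfl⟩
    rwa [range_eq_frob_fixed _ hN0 hF'] at this
  have hsub : ((q - 1 : ℕ) : ℚ) = (q : ℚ) - 1 := by
    rw [Nat.cast_sub (by omega), Nat.cast_one]
  have hq4 : (4 : ℚ) ≤ q := by exact_mod_cast (by omega : 4 ≤ q)
  have d1 : (q : ℚ) - 1 ≠ 0 := by linarith
  have d2 : (q : ℚ) + 1 ≠ 0 := by linarith
  have d3 : (q : ℚ) ≠ 0 := by linarith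
  have d4 : (q : ℚ) ^ 2 - 1 ≠ 0 := by
    rw [show (q : ℚ) ^ 2 - 1 = (q - 1) * (q + 1) by ring]
    exact mul_ne_zero d1 d2
  have hcast {c0 c1 ch cf : ℕ} (e4 : c0 + c1 + ch + cf + 1 = q ^ (k + 1)) :
      (c0 : ℚ) + c1 + ch + cf + 1 = q * (q : ℚ) ^ k := by
    rw [← pow_succ']
    exact_mod_cast e4
  refine ⟨?_, fun hme => ?_, fun hmo => ?_⟩
  · intro a ha
    have ha0 : algebraMap F (AlgebraicClosure F) a ≠ 0 := by simpa using ha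
    rw [hqh]
    rcases Nat.even_or_odd (k + 1) with hme | hmo
    · exact (valueCount_even hn0 hm0 hme hh hh2).2.2.2.2 _ (hfix a) ha0
    · exact (valueCount_odd hn0 hmo hh hh2).2.2.2.2 _ (hfix a) ha0
  · obtain ⟨e1, e2, e3, e4, -⟩ := valueCount_even (K := AlgebraicClosure F) hn0 hm0 hme hh hh2
    rw [← hqh] at e1 e2 e3 e4
    rw [hqm] at e1 e2 e3 e4
    rw [← hq] at e2 e3
    rw [add_tsub_cancel_right]
    generalize valueCount (AlgebraicClosure F) n (n * (k + 1)) 0 = c0 at *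
    generalize valueCount (AlgebraicClosure F) n (n * (k + 1)) 1 = c1 at *
    generalize valueCount (AlgebraicClosure F) n (n * (k + 1)) h = ch at *
    generalize valueCount (AlgebraicClosure F) n (n * (k + 1)) (h * (q - 1)) = cf at *
    have E1 : (q : ℚ) * ch = q * (q : ℚ) ^ k := by
      rw [← pow_succ']
      exact_mod_cast e1
    have E2 : 2 * (c1 : ℚ) + q * (q - 1) * cf + q = q * (q : ℚ) ^ k := by
      rw [← pow_succ', ← hsub]
      exact_mod_cast e2
    have E3 : ((q : ℚ) + 1) * (q * (q - 1) * cf) + q ^ 2 = q * (q : ℚ) ^ k := by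
      rw [← pow_succ', ← hsub]
      exact_mod_cast e3
    have E4 := hcast e4
    have Gh : (ch : ℚ) = (q : ℚ) ^ k := mul_left_cancel₀ d3 (by linear_combination E1)
    have Gf : (cf : ℚ) * ((q : ℚ) ^ 2 - 1) = (q : ℚ) ^ k - q :=
      mul_left_cancel₀ d3 (by linear_combination E3)
    have G1 : (c1 : ℚ) * (2 * ((q : ℚ) + 1)) = (q : ℚ) ^ (k + 1 + 1) - q := by
      linear_combination ((q : ℚ) + 1) * E2 - E3
    refine ⟨?_, ?_, Gh, ?_⟩
    · rw [eq_div_iff (mul_ne_zero two_ne_zero d1)]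
      -- Multiplying by `q + 1` clears the denominators of `c_1` and `c_{(q/2)(q-1)}` together.
      apply mul_right_cancel₀ d2
      linear_combination 2 * ((q : ℚ) ^ 2 - 1) * E4 - ((q : ℚ) - 1) * G1 - 2 * Gf
        - 2 * ((q : ℚ) ^ 2 - 1) * Gh
    · rw [eq_div_iff (mul_ne_zero two_ne_zero d2), G1]
    · rw [eq_div_iff d4, Gf]
  · obtain ⟨e1, e2, e3, e4, -⟩ := valueCount_odd (K := AlgebraicClosure F) hn0 hmo hh hh2
    rw [← hqh] at e1 e2 e3 e4
    rw [hqm] at e1 e2 e3 e4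
    rw [← hq] at e1 e3
    rw [add_tsub_cancel_right]
    generalize valueCount (AlgebraicClosure F) n (n * (k + 1)) 0 = c0 at *
    generalize valueCount (AlgebraicClosure F) n (n * (k + 1)) 1 = c1 at *
    generalize valueCount (AlgebraicClosure F) n (n * (k + 1)) h = ch at *
    generalize valueCount (AlgebraicClosure F) n (n * (k + 1)) (h * (q - 1)) = cf at *
    have E1 : (q : ℚ) * ch + q = q * (q : ℚ) ^ k := by
      rw [← pow_succ']
      exact_mod_cast e1
    have E2 : 2 * (c1 : ℚ) + q * (q - 1) * cf = q * (q : ℚ) ^ k := by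
      rw [← pow_succ', ← hsub]
      exact_mod_cast e2
    have E3 : ((q : ℚ) + 1) * (q * (q - 1) * cf) + q = q * (q : ℚ) ^ k := by
      rw [← pow_succ', ← hsub]
      exact_mod_cast e3
    have E4 := hcast e4
    have Gh : (ch : ℚ) = (q : ℚ) ^ k - 1 := mul_left_cancel₀ d3 (by linear_combination E1)
    have Gf : (cf : ℚ) * ((q : ℚ) ^ 2 - 1) = (q : ℚ) ^ k - 1 :=
      mul_left_cancel₀ d3 (by linear_combination E3)
    have G1 : (c1 : ℚ) * (2 * ((q : ℚ) + 1)) = (q : ℚ) ^ (k + 1 + 1) + q := by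
      linear_combination ((q : ℚ) + 1) * E2 - E3
    refine ⟨?_, ?_, Gh, ?_⟩
    · rw [eq_div_iff (mul_ne_zero two_ne_zero d1)]
      apply mul_right_cancel₀ d2
      linear_combination 2 * ((q : ℚ) ^ 2 - 1) * E4 - ((q : ℚ) - 1) * G1 - 2 * Gf
        - 2 * ((q : ℚ) ^ 2 - 1) * Gh
    · rw [eq_div_iff (mul_ne_zero two_ne_zero d2), G1]
    · rw [eq_div_iff d4, Gf]
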